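/- Let $q\in\mathbb{C}$, $q\neq 0$. Let $\mathcal{B}(q)$ be the Block algebra: the complex Lie algebra with basis $\{L_{\mathbf m}:\mathbf m=(m_1,m_2)\in\mathbb{Z}^2\}$ and brackets $$[L_{\mathbf m},L_{\mathbf n}]=\bigl(n_1(m_2+q)-m_1(n_2+q)\bigr)L_{\mathbf m+\mathbf n}.$$ Let $\mathcal{B}'(q)=\mathcal{B}(q)\ltimes\mathbb{C}\partial_2$, where $\partial_2$ is the derivation $\partial_2(L_{\mathbf m})=m_2L_{\mathbf m}$; put $\partial_1=q^{-1}L_{\mathbf 0}\in\mathcal{B}'(q)$, so that $[\partial_1,L_{\mathbf m}]=m_1L_{\mathbf m}$, and $\mathfrak{h}=\mathbb{C}\partial_1\oplus\mathbb{C}\partial_2$, an abelian subalgebra with $U(\mathfrak h)=\mathbb{C}[\partial_1,\partial_2]$. A $\mathcal{B}'(q)$-module is called $U(\mathfrak{h})$-free of rank $1$ if its restriction to $U(\mathfrak{h})$ is a free module of rank $1$; a $\mathcal{B}(q)$-module is called $U(\mathfrak{h})$-free of rank $1$ if its action extends to a $\mathcal{B}'(q)$-action with this property. For $\lambda=(\lambda_1,\lambda_2)\in\mathbb{C}^2$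 with $\lambda_1\lambda_2\neq0$ and $\alpha\in\mathbb{C}$, let $\Omega(\lambda,\alpha)=\mathbb{C}[\partial_1,\partial_2]$ be the $\mathcal{B}'(q)$-module on which $\partial_1,\partial_2$ act by multiplication and $$L_{\mathbf m}\cdot f(\partial_1,\partial_2)=\lambda_1^{m_1}\lambda_2^{m_2}\bigl(\partial_1(q+m_2)-m_1(q\alpha+\partial_2)\bigr)f(\partial_1-m_1,\partial_2-m_2),\qquad \mathbf m\in\mathbb{Z}^2.$$ Theorem. Every $U(\mathfrak{h})$-free $\mathcal{B}'(q)$-module of rank $1$ is isomorphic, as a $\mathcal{B}'(q)$-module, to $\Omega(\lambda,\alpha)$ for some $\lambda=(\lambda_1,\lambda_2)\in\mathbb{C}^2$ with $\lambda_1,\lambda_2\neq0$ and some $\alpha\in\mathbb{C}$. Likewise, every $U(\mathfrak{h})$-free $\mathcal{B}(q)$-module of rank $1$ is isomorphic, as a $\mathcal{B}(q)$-module, to some such $\Omega(\lambda,\alpha)$. -/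

import Mathlib

noncomputable section

attribute [local instance 100] LieRing.ofAssociativeRing

/-! ### The Block algebra -/

/-- The underlying vector space of the Block algebra `ℬ(q)`: it has a basis `L_m`, `m ∈ ℤ²`. -/
def Block (_q : ℂ) : Type := (ℤ × ℤ) →₀ ℂ

namespace Block

instance (q : ℂ) : AddCommGroup (Block q) := inferInstanceAs (AddCommGroup ((ℤ × ℤ) →₀ ℂ))

instance (q : ℂ) : Module ℂ (Block q) := inferInstanceAs (Module ℂ ((ℤ × ℤ) →₀ ℂ))

/-- The basis `(L_m)`, `m ∈ ℤ²`, of `ℬ(q)`. -/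
def basis (q : ℂ) : Module.Basis (ℤ × ℤ) ℂ (Block q) :=
  Module.Basis.ofRepr (LinearEquiv.refl ℂ ((ℤ × ℤ) →₀ ℂ))

/-- The basis element `L_m`. -/
def L (q : ℂ) (m : ℤ × ℤ) : Block q := basis q m

/-- A property of elements of `ℬ(q)` that is stable under linear combinations and holds for all
`L_m` holds for all elements. -/
lemma induction {q : ℂ} {P : Block q → Prop} (x : Block q) (zero : P 0)
    (add : ∀ x₁ x₂, P x₁ → P x₂ → P (x₁ + x₂)) (smul : ∀ (c : ℂ) x, P x → P (c • x))
    (basis : ∀ m, P (L q m)) : P x := by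
  have hx : x ∈ Submodule.span ℂ (Set.range (Block.basis q)) := by
    rw [(Block.basis q).span_eq]; trivial
  induction hx using Submodule.span_induction with
  | mem x h => obtain ⟨m, rfl⟩ := h; exact basis m
  | zero => exact zero
  | add x y _ _ hx hy => exact add x y hx hy
  | smul c x _ h => exact smul c x h

/-- The structure constant `n₁ (m₂ + q) - m₁ (n₂ + q)`. -/
def coeff (q : ℂ) (m n : ℤ × ℤ) : ℂ := n.1 * (m.2 + q) - m.1 * (n.2 + q)

/-- The bilinear map with `(L_m, L_n) ↦ (n₁ (m₂ + q) - m₁ (n₂ + q)) L_{m+n}`. -/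
def bracketₗ (q : ℂ) : Block q →ₗ[ℂ] Block q →ₗ[ℂ] Block q :=
  (basis q).constr ℂ fun m => (basis q).constr ℂ fun n => coeff q m n • L q (m + n)

lemma bracketₗ_L_L (q : ℂ) (m n : ℤ × ℤ) :
    bracketₗ q (L q m) (L q n) = coeff q m n • L q (m + n) := by
  simp [bracketₗ, L]

lemma bracketₗ_skew (q : ℂ) (x y : Block q) : bracketₗ q x y = -bracketₗ q y x := by
  have h : bracketₗ q = -(bracketₗ q).flip := by
    refine (basis q).ext fun m => (basis q).ext fun n => ?_
    have h1 := bracketₗ_L_L q m n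
    have h2 := bracketₗ_L_L q n m
    simp only [L] at h1 h2
    simp only [LinearMap.neg_apply, LinearMap.flip_apply, h1, h2, add_comm n m, ← neg_smul]
    congr 1
    simp only [coeff]; ring
  exact congrArg (fun f => f x y) h

lemma bracketₗ_leibniz (q : ℂ) (x y z : Block q) :
    bracketₗ q x (bracketₗ q y z) =
      bracketₗ q (bracketₗ q x y) z + bracketₗ q y (bracketₗ q x z) := by
  induction x using Block.induction with
  | zero => simp
  | add x₁ x₂ h₁ h₂ => simp only [map_add, LinearMap.add_apply, h₁, h₂]; abel
  | smul c x h => simp only [map_smul, LinearMap.smul_apply, h, smul_add]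
  | basis m =>
  induction y using Block.induction with
  | zero => simp
  | add x₁ x₂ h₁ h₂ => simp only [map_add, LinearMap.add_apply, h₁, h₂]; abel
  | smul c x h => simp only [map_smul, LinearMap.smul_apply, h, smul_add]
  | basis n =>
  induction z using Block.induction with
  | zero => simp
  | add x₁ x₂ h₁ h₂ => simp only [map_add, h₁, h₂]; abel
  | smul c x h => simp only [map_smul, h, smul_add]
  | basis k =>
  simp only [bracketₗ_L_L, map_smul, LinearMap.smul_apply, smul_smul]
  rw [← add_assoc n m k, add_comm n m, ← add_assoc, ← add_smul]
  congr 1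
  simp only [coeff, Prod.fst_add, Prod.snd_add]; push_cast; ring

instance (q : ℂ) : LieRing (Block q) where
  bracket x y := bracketₗ q x y
  add_lie x y z := by simp
  lie_add x y z := by simp
  lie_self x := by
    have h : (2 : ℂ) • bracketₗ q x x = 0 := by
      rw [two_smul]; nth_rw 1 [bracketₗ_skew]; exact neg_add_cancel _
    exact (smul_eq_zero.mp h).resolve_left two_ne_zero
  leibniz_lie x y z := bracketₗ_leibniz q x y z

instance (q : ℂ) : LieAlgebra ℂ (Block q) where
  lie_smul c x y := map_smul (bracketₗ q x) c y

lemma lie_L_L (q : ℂ) (m n : ℤ × ℤ) :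
    ⁅L q m, L q n⁆ = ((n.1 : ℂ) * (m.2 + q) - m.1 * (n.2 + q)) • L q (m + n) :=
  bracketₗ_L_L q m n

/-- The degree derivation `∂₂` of `ℬ(q)`, given by `∂₂ (L_m) = m₂ L_m`. -/
def degDer₂ (q : ℂ) : LieDerivation ℂ (Block q) (Block q) where
  toLinearMap := (basis q).constr ℂ fun m => (m.2 : ℂ) • L q m
  leibniz' x y := by
    induction x using Block.induction with
    | zero => simp
    | add x₁ x₂ h₁ h₂ =>
      simp only [add_lie, lie_add, map_add, h₁, h₂]; abel
    | smul c x h => simp only [smul_lie, lie_smul, map_smul, h, smul_sub]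
    | basis m =>
    induction y using Block.induction with
    | zero => simp
    | add x₁ x₂ h₁ h₂ =>
      simp only [add_lie, lie_add, map_add, h₁, h₂]; abel
    | smul c x h => simp only [smul_lie, lie_smul, map_smul, h, smul_sub]
    | basis n =>
    have d : ∀ a, (basis q).constr ℂ (fun m => (m.2 : ℂ) • L q m) (L q a) = (a.2 : ℂ) • L q a :=
      fun a => (basis q).constr_basis ℂ _ a
    simp only [lie_L_L, map_smul, d, lie_smul, smul_smul]
    rw [add_comm n m, ← sub_smul]
    congr 1
    simp only [Prod.snd_add]; push_cast; ring

lemma degDer₂_L (q : ℂ) (m : ℤ × ℤ) : degDer₂ q (L q m) = (m.2 : ℂ) • L q m :=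
  (basis q).constr_basis ℂ _ m

/-- The action of the one-dimensional Lie algebra `ℂ ∂₂` (identified with `ℂ`) by derivations. -/
def degAction (q : ℂ) : ℂ →ₗ⁅ℂ⁆ LieDerivation ℂ (Block q) (Block q) where
  toFun c := c • degDer₂ q
  map_add' c d := add_smul c d _
  map_smul' c d := by simp [mul_smul]
  map_lie' {c d} := by
    rw [LieRing.of_associative_ring_bracket, mul_comm, sub_self]
    simp

end Block

open LieAlgebra

/-- The extended Block algebra `ℬ'(q) = ℬ(q) ⋊ ℂ ∂₂` (in the case `q ≠ 0`). -/
abbrev BlockExt (q : ℂ) : Type := Block q ⋊⁅Block.degAction q⁆ ℂ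

namespace BlockExt

/-- The inclusion `ℬ(q) → ℬ'(q)`. -/
def incl (q : ℂ) : Block q →ₗ⁅ℂ⁆ BlockExt q := SemiDirectSum.inl (Block.degAction q)

/-- The element `∂₁ = q⁻¹ L_0` of `ℬ'(q)`; for `q ≠ 0` it acts on `ℬ(q)` by
`[∂₁, L_m] = m₁ L_m`. -/
def del₁ (q : ℂ) : BlockExt q := q⁻¹ • incl q (Block.L q 0)

/-- The element `∂₂` of `ℬ'(q)`. -/
def del₂ (q : ℂ) : BlockExt q := SemiDirectSum.inr (Block.degAction q) 1

lemma lie_del₁_L (q : ℂ) (hq : q ≠ 0) (m : ℤ × ℤ) :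
    ⁅del₁ q, incl q (Block.L q m)⁆ = (m.1 : ℂ) • incl q (Block.L q m) := by
  rw [del₁, smul_lie, ← LieHom.map_lie, Block.lie_L_L]
  simp only [map_smul, smul_smul, zero_add]
  congr 1
  simp only [Prod.fst_zero, Prod.snd_zero, Int.cast_zero, zero_add, zero_mul, sub_zero]
  field_simp

lemma lie_del₂_L (q : ℂ) (m : ℤ × ℤ) :
    ⁅del₂ q, incl q (Block.L q m)⁆ = (m.2 : ℂ) • incl q (Block.L q m) := by
  have h : Block.degAction q 1 (Block.L q m) = (m.2 : ℂ) • Block.L q m := by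
    rw [← Block.degDer₂_L]; exact one_smul ℂ (Block.degDer₂ q (Block.L q m))
  simp [del₂, incl, h]

lemma lie_del₁_del₂ (q : ℂ) : ⁅del₁ q, del₂ q⁆ = 0 := by
  rw [del₁, smul_lie, ← lie_skew, lie_del₂_L]
  simp

/-- The Cartan subalgebra `𝔥 = ℂ ∂₁ ⊕ ℂ ∂₂` of `ℬ'(q)`. -/
def cartan (q : ℂ) : LieSubalgebra ℂ (BlockExt q) where
  toSubmodule := Submodule.span ℂ {del₁ q, del₂ q}
  lie_mem' {x y} hx hy := by
    obtain ⟨a, b, rfl⟩ := Submodule.mem_span_pair.mp hx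
    obtain ⟨c, d, rfl⟩ := Submodule.mem_span_pair.mp hy
    have h : ⁅del₂ q, del₁ q⁆ = 0 := by rw [← lie_skew, lie_del₁_del₂, neg_zero]
    simp only [add_lie, lie_add, smul_lie, lie_smul, lie_self, lie_del₁_del₂, h, smul_zero,
      add_zero]
    exact Submodule.zero_mem _

/-- The universal enveloping algebra `U(𝔥)`. -/
abbrev UCartan (q : ℂ) : Type := UniversalEnvelopingAlgebra ℂ (cartan q)

/-- The `U(𝔥)`-module structure on a `ℬ'(q)`-module, obtained by restriction to `𝔥`. -/
abbrev uCartanModule (q : ℂ) (M : Type*) [AddCommGroup M] [Module ℂ M]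
    [LieRingModule (BlockExt q) M] [LieModule ℂ (BlockExt q) M] : Module (UCartan q) M :=
  Module.compHom M
    (UniversalEnvelopingAlgebra.lift ℂ (LieModule.toEnd ℂ (cartan q) M)).toRingHom

/-- A `ℬ'(q)`-module is `U(𝔥)`-free of rank `r` if, by restriction, it is a free `U(𝔥)`-module
of rank `r`. -/
def IsUhFree (q : ℂ) (r : ℕ) (M : Type*) [AddCommGroup M] [Module ℂ M]
    [LieRingModule (BlockExt q) M] [LieModule ℂ (BlockExt q) M] : Prop :=
  letI : Module (UCartan q) M := uCartanModule q M
  Nonempty (Module.Basis (Fin r) (UCartan q) M)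

end BlockExt

/-- A `ℬ(q)`-module is called `U(𝔥)`-free of rank `r` if its action is the restriction of a
`ℬ'(q)`-action which is `U(𝔥)`-free of rank `r`. -/
def Block.IsUhFree (q : ℂ) (r : ℕ) (M : Type*) [AddCommGroup M] [Module ℂ M]
    [LieRingModule (Block q) M] : Prop :=
  ∃ (_ : LieRingModule (BlockExt q) M) (_ : LieModule ℂ (BlockExt q) M),
    (∀ (x : Block q) (v : M), ⁅BlockExt.incl q x, v⁆ = ⁅x, v⁆) ∧ BlockExt.IsUhFree q r M

/-! ### The modules `Ω(λ, α)` -/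

/-- The vector space `Ω(λ, α) = ℂ[∂₁, ∂₂]`, with `∂₁ = X 0` and `∂₂ = X 1`. -/
def Omega (_q : ℂ) (_lam₁ _lam₂ : ℂˣ) (_α : ℂ) : Type := MvPolynomial (Fin 2) ℂ

namespace Omega

open MvPolynomial

/-- The substitution `f(∂₁, ∂₂) ↦ f(∂₁ - m₁, ∂₂ - m₂)`. -/
def shift (m : ℤ × ℤ) : MvPolynomial (Fin 2) ℂ →ₐ[ℂ] MvPolynomial (Fin 2) ℂ :=
  aeval ![X 0 - C (m.1 : ℂ), X 1 - C (m.2 : ℂ)]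

lemma shift_shift (m n : ℤ × ℤ) (f : MvPolynomial (Fin 2) ℂ) :
    shift m (shift n f) = shift (m + n) f := by
  have h : (shift m).comp (shift n) = shift (m + n) := by
    ext i : 1
    fin_cases i <;> simp [shift] <;> ring
  exact congrArg (fun g => g f) h

/-- The polynomial `λ₁^{m₁} λ₂^{m₂} (∂₁ (q + m₂) - m₁ (q α + ∂₂))`. -/
def gPoly (q : ℂ) (lam₁ lam₂ : ℂˣ) (α : ℂ) (m : ℤ × ℤ) : MvPolynomial (Fin 2) ℂ :=
  C ((lam₁ : ℂ) ^ m.1 * (lam₂ : ℂ) ^ m.2) *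
    (X 0 * C (q + m.2) - C (m.1 : ℂ) * (C (q * α) + X 1))

/-- The operator
`f ↦ λ₁^{m₁} λ₂^{m₂} (∂₁ (q + m₂) - m₁ (q α + ∂₂)) f(∂₁ - m₁, ∂₂ - m₂)`. -/
def opL (q : ℂ) (lam₁ lam₂ : ℂˣ) (α : ℂ) (m : ℤ × ℤ) :
    Module.End ℂ (MvPolynomial (Fin 2) ℂ) :=
  LinearMap.mulLeft ℂ (gPoly q lam₁ lam₂ α m) ∘ₗ (shift m).toLinearMap

lemma opL_apply (q : ℂ) (lam₁ lam₂ : ℂˣ) (α : ℂ) (m : ℤ × ℤ) (f : MvPolynomial (Fin 2) ℂ) :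
    opL q lam₁ lam₂ α m f = gPoly q lam₁ lam₂ α m * shift m f := rfl

lemma opL_comm (q : ℂ) (lam₁ lam₂ : ℂˣ) (α : ℂ) (m n : ℤ × ℤ) :
    ⁅opL q lam₁ lam₂ α m, opL q lam₁ lam₂ α n⁆ =
      Block.coeff q m n • opL q lam₁ lam₂ α (m + n) := by
  refine LinearMap.ext fun f => ?_
  simp only [LieRing.of_associative_ring_bracket, LinearMap.sub_apply, Module.End.mul_apply,
    opL_apply, map_mul, shift_shift, LinearMap.smul_apply, smul_eq_C_mul, add_comm n m]
  simp only [gPoly, shift, map_mul, map_sub, map_add, aeval_X, aeval_C, Matrix.cons_val_zero,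
    Matrix.cons_val_one, Block.coeff, Prod.fst_add, Prod.snd_add, zpow_add₀ lam₁.ne_zero,
    zpow_add₀ lam₂.ne_zero, algebraMap_eq, Int.cast_add]
  ring

lemma end_smul_lie (c : ℂ) (a b : Module.End ℂ (MvPolynomial (Fin 2) ℂ)) :
    ⁅c • a, b⁆ = c • ⁅a, b⁆ := smul_lie c a b

lemma end_lie_smul (c : ℂ) (a b : Module.End ℂ (MvPolynomial (Fin 2) ℂ)) :
    ⁅a, c • b⁆ = c • ⁅a, b⁆ := lie_smul c a b

/-- The representation of `ℬ(q)` on `ℂ[∂₁, ∂₂]` in which `L_m` acts by `opL m`. -/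
def rep (q : ℂ) (lam₁ lam₂ : ℂˣ) (α : ℂ) :
    Block q →ₗ⁅ℂ⁆ Module.End ℂ (MvPolynomial (Fin 2) ℂ) where
  toLinearMap := (Block.basis q).constr ℂ (opL q lam₁ lam₂ α)
  map_lie' {x y} := by
    have d : ∀ a, (Block.basis q).constr ℂ (opL q lam₁ lam₂ α) (Block.L q a) =
      opL q lam₁ lam₂ α a := fun a => (Block.basis q).constr_basis ℂ _ a
    show (Block.basis q).constr ℂ (opL q lam₁ lam₂ α) ⁅x, y⁆ =
      ⁅(Block.basis q).constr ℂ (opL q lam₁ lam₂ α) x,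
        (Block.basis q).constr ℂ (opL q lam₁ lam₂ α) y⁆
    induction x using Block.induction with
    | zero => simp
    | add x₁ x₂ h₁ h₂ => simp only [add_lie, map_add, h₁, h₂]
    | smul c x h => simp only [smul_lie, map_smul, end_smul_lie, h]
    | basis m =>
    induction y using Block.induction with
    | zero => simp
    | add x₁ x₂ h₁ h₂ => simp only [lie_add, map_add, h₁, h₂]
    | smul c x h => simp only [lie_smul, map_smul, end_lie_smul, h]
    | basis n =>
    rw [Block.lie_L_L, map_smul, d, d, d, opL_comm]
    rfl

lemma rep_L (q : ℂ) (lam₁ lam₂ : ℂˣ) (α : ℂ) (m : ℤ × ℤ) :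
    rep q lam₁ lam₂ α (Block.L q m) = opL q lam₁ lam₂ α m :=
  (Block.basis q).constr_basis ℂ _ m

/-- Multiplication by `∂₂`. -/
def opDel₂ : Module.End ℂ (MvPolynomial (Fin 2) ℂ) := LinearMap.mulLeft ℂ (X 1)

lemma opDel₂_comm (q : ℂ) (lam₁ lam₂ : ℂˣ) (α : ℂ) (x : Block q) :
    ⁅opDel₂, rep q lam₁ lam₂ α x⁆ = rep q lam₁ lam₂ α (Block.degDer₂ q x) := by
  induction x using Block.induction with
  | zero => simp
  | add x₁ x₂ h₁ h₂ => simp only [lie_add, map_add, h₁, h₂]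
  | smul c x h => simp only [map_smul, end_lie_smul, h]
  | basis m =>
  rw [Block.degDer₂_L, map_smul, rep_L]
  refine LinearMap.ext fun f => ?_
  simp only [LieRing.of_associative_ring_bracket, LinearMap.sub_apply, Module.End.mul_apply,
    opL_apply, opDel₂, LinearMap.mulLeft_apply, map_mul, LinearMap.smul_apply, smul_eq_C_mul]
  simp only [shift, aeval_X, Matrix.cons_val_one]
  simp
  ring

/-- The representation of `ℬ'(q)` on `ℂ[∂₁, ∂₂]` which extends `rep` and in which `∂₂` acts by
multiplication. -/
def repExt (q : ℂ) (lam₁ lam₂ : ℂˣ) (α : ℂ) :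
    BlockExt q →ₗ⁅ℂ⁆ Module.End ℂ (MvPolynomial (Fin 2) ℂ) where
  toFun x := rep q lam₁ lam₂ α x.left + x.right • opDel₂
  map_add' x y := by simp [add_smul]; abel
  map_smul' c x := by simp [mul_smul]
  map_lie' {x y} := by
    have h : ∀ z, ⁅rep q lam₁ lam₂ α z, opDel₂⁆ = -rep q lam₁ lam₂ α (Block.degDer₂ q z) :=
      fun z => by rw [← lie_skew, opDel₂_comm]
    have h0 : ⁅x.right, y.right⁆ = 0 := by
      rw [LieRing.of_associative_ring_bracket, mul_comm, sub_self]
    have h3 : ∀ (c : ℂ) (z : Block q), Block.degAction q c z = c • Block.degDer₂ q z :=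
      fun _ _ => rfl
    have h4 : ⁅opDel₂, opDel₂⁆ = 0 := lie_self _
    simp only [SemiDirectSum.lie_eq_mk, h0, zero_smul, add_zero, map_add, map_sub, lie_add,
      add_lie, LieHom.map_lie, end_smul_lie, end_lie_smul, h3, h4, smul_zero, h, opDel₂_comm, map_smul, smul_neg]
    abel

variable (q : ℂ) (lam₁ lam₂ : ℂˣ) (α : ℂ)

instance : AddCommGroup (Omega q lam₁ lam₂ α) :=
  inferInstanceAs (AddCommGroup (MvPolynomial (Fin 2) ℂ))

instance : Module ℂ (Omega q lam₁ lam₂ α) :=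
  inferInstanceAs (Module ℂ (MvPolynomial (Fin 2) ℂ))

/-- The `ℬ'(q)`-module structure of `Ω(λ, α)`. -/
instance : LieRingModule (BlockExt q) (Omega q lam₁ lam₂ α) where
  bracket x f := repExt q lam₁ lam₂ α x f
  add_lie x y f := by
    show repExt q lam₁ lam₂ α (x + y) f = _
    rw [map_add]; rfl
  lie_add x f g := map_add (repExt q lam₁ lam₂ α x) f g
  leibniz_lie x y f := by
    show repExt q lam₁ lam₂ α x (repExt q lam₁ lam₂ α y f) =
      repExt q lam₁ lam₂ α ⁅x, y⁆ f + repExt q lam₁ lam₂ α y (repExt q lam₁ lam₂ α x f)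
    rw [LieHom.map_lie]
    exact (sub_add_cancel _ _).symm

instance : LieModule ℂ (BlockExt q) (Omega q lam₁ lam₂ α) where
  smul_lie c x f := by
    show repExt q lam₁ lam₂ α (c • x) f = _
    rw [map_smul]; rfl
  lie_smul c x f := map_smul (repExt q lam₁ lam₂ α x) c f

/-- The identification of `Ω(λ, α)` with `ℂ[∂₁, ∂₂]`. -/
def toPoly : Omega q lam₁ lam₂ α ≃ₗ[ℂ] MvPolynomial (Fin 2) ℂ :=
  LinearEquiv.refl ℂ (MvPolynomial (Fin 2) ℂ)

lemma toPoly_lie_L (m : ℤ × ℤ) (f : Omega q lam₁ lam₂ α) :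
    toPoly q lam₁ lam₂ α ⁅BlockExt.incl q (Block.L q m), f⁆ =
      gPoly q lam₁ lam₂ α m * shift m (toPoly q lam₁ lam₂ α f) := by
  have h : repExt q lam₁ lam₂ α (BlockExt.incl q (Block.L q m)) = opL q lam₁ lam₂ α m := by
    show rep q lam₁ lam₂ α (Block.L q m) + (0 : ℂ) • opDel₂ = _
    rw [zero_smul, add_zero, rep_L]
  exact congrArg (fun T => T (toPoly q lam₁ lam₂ α f)) h

lemma toPoly_lie_del₁ (hq : q ≠ 0) (f : Omega q lam₁ lam₂ α) :
    toPoly q lam₁ lam₂ α ⁅BlockExt.del₁ q, f⁆ = X 0 * toPoly q lam₁ lam₂ α f := by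
  have h0 : shift 0 = AlgHom.id ℂ _ := by
    ext i : 1
    fin_cases i <;> simp [shift]
  rw [BlockExt.del₁, smul_lie, map_smul, toPoly_lie_L, h0, AlgHom.id_apply, ← smul_mul_assoc]
  congr 1
  simp only [gPoly, smul_eq_C_mul, Prod.fst_zero, Prod.snd_zero, zpow_zero, mul_one, C_1, one_mul,
    Int.cast_zero, add_zero, C_0, zero_mul, sub_zero]
  rw [mul_left_comm, ← C_mul, inv_mul_cancel₀ hq, C_1, mul_one]

lemma toPoly_lie_del₂ (f : Omega q lam₁ lam₂ α) :
    toPoly q lam₁ lam₂ α ⁅BlockExt.del₂ q, f⁆ = X 1 * toPoly q lam₁ lam₂ α f := by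
  have h : repExt q lam₁ lam₂ α (BlockExt.del₂ q) = opDel₂ := by
    show rep q lam₁ lam₂ α 0 + (1 : ℂ) • opDel₂ = _
    rw [one_smul, map_zero, zero_add]
  exact congrArg (fun T => T (toPoly q lam₁ lam₂ α f)) h

/-- The `ℬ(q)`-module structure of `Ω(λ, α)`. -/
instance : LieRingModule (Block q) (Omega q lam₁ lam₂ α) :=
  LieRingModule.compLieHom (Omega q lam₁ lam₂ α) (BlockExt.incl q)

instance : LieModule ℂ (Block q) (Omega q lam₁ lam₂ α) :=
  LieModule.compLieHom (Omega q lam₁ lam₂ α) (BlockExt.incl q)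

end Omega

end

/-! Since `[∂ᵢ, L_m] = mᵢ L_m`, on a module identified with `ℂ[∂₁, ∂₂]` each `L_m` acts as `f ↦ g_m
· f(∂ - m)`, where `g_m` is the image of `1`. The classification thus becomes the solution of the
functional equations `IsBlockFamily` for the polynomials `g_m`, with `g_0 = q ∂₁`.

For `m₁ ≠ 0` the elements `L_{jm}`, `j ∈ ℤ`, span a Witt algebra, and translation by `jm` fixes `t =
m₂ ∂₁ - m₁ ∂₂`. Over `ℂ[t]` this is a rank-one problem for the Witt algebra in the single variable
`∂₁`. Degree considerations force every member of the family to be linear, and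
`IsWittFamily.exists_unit` gives `g_m = l (q ∂₁ + A(t))` with a scalar `l` and an as yet arbitrary
polynomial `A`.

Brackets between two neighbouring directions make `A` affine (`natDegree_le_one_of_bracket`). On the
level `m₁ = 1` there remain the scalars `l i`, the slopes `β i` and the constants `b i`. The
relations make `β` constant and equal to `1`, `l` geometric and `b` constant (`exists_level_one`).
Brackets then propagate the formula to all `m₁ ≠ 0`, and the level `m₁ = 0` is read off on the zero
lines of the `g (1, i)` (`exists_eq`). The ratio and initial value of `l` give `λ`, and `b` gives
`α`. -/

namespace Polynomial

/-! ### Polynomials under translation -/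

variable {R : Type*} [CommRing R]

lemma coeff_taylor_of_natDegree_le {f : R[X]} {n : ℕ} (hf : f.natDegree ≤ n + 1) (h : R) :
    (taylor h f).coeff n = f.coeff n + (n + 1) * h * f.coeff (n + 1) := by
  have hd : (hasseDeriv n f).natDegree < 2 := by
    have := natDegree_hasseDeriv_le f n
    omega
  rw [taylor_coeff, eval_eq_sum_range' hd]
  simp [Finset.sum_range_succ, hasseDeriv_coeff, Nat.choose_succ_self_right, add_comm 1 n]
  ring

lemma coeff_taylor_of_natDegree_le' {f : R[X]} {n : ℕ} (hf : f.natDegree ≤ n) (h : R) :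
    (taylor h f).coeff n = f.coeff n := by
  rw [coeff_taylor_of_natDegree_le (hf.trans n.le_succ), coeff_eq_zero_of_natDegree_lt (n := n + 1) (by omega)]
  simp

variable [IsDomain R] [CharZero R]

/-- If `P` has degree `n + 1`, the difference has coefficient `(n + 1) h · lead P` at `n`, which is
nonzero in a domain of characteristic zero. Hence `n = 1`, and comparison with `2h` gives the
leading coefficient. -/
lemma natDegree_eq_two_of_taylor_sub {P : R[X]} {h : R} (hh : h ≠ 0)
    (hP : taylor h P - P = C (2 * h) * X) : P.natDegree = 2 ∧ P.leadingCoeff = 1 := by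
  rcases hd : P.natDegree with _ | n
  · rw [natDegree_eq_zero] at hd
    obtain ⟨c, rfl⟩ := hd
    have := congrArg (coeff · 1) hP
    simp at this
    exact absurd this hh
  have hc : P.coeff (n + 1) ≠ 0 := by
    rw [← hd]
    intro h0
    rw [coeff_natDegree, leadingCoeff_eq_zero] at h0
    simp [h0] at hd
  have key := congrArg (coeff · n) hP
  simp only [coeff_sub, coeff_taylor_of_natDegree_le hd.le, coeff_C_mul, coeff_X] at key
  have hn : (n + 1 : R) ≠ 0 := by exact_mod_cast n.succ_ne_zero
  obtain rfl : n = 1 := by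
    by_contra hne
    rw [if_neg (Ne.symm hne)] at key
    have : (n + 1) * h * P.coeff (n + 1) = 0 := by linear_combination key
    simp_all
  refine ⟨rfl, ?_⟩
  rw [leadingCoeff, hd]
  have : 2 * h * (P.coeff (1 + 1) - 1) = 0 := by
    simp at key; linear_combination key
  simpa [hh, sub_eq_zero] using this

/-! ### Rank-one modules over the Witt algebra -/

/-- A family satisfying the defining relations of a module over the Witt algebra that is free of
rank one over the polynomial ring. -/
structure IsWittFamily (k : R) (r : ℤ → R[X]) : Prop where
  ne_zero : k ≠ 0
  zero : r 0 = X
  rel (i j : ℤ) : r i * taylor (-(i * k)) (r j) - r j * taylor (-(j * k)) (r i) =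
    C (k * (j - i)) * r (i + j)

namespace IsWittFamily

variable {k : R} {r : ℤ → R[X]} (hr : IsWittFamily k r)
include hr

/-- For `P(x) = r_j(x) r_{-j}(x - jk)`, the relation between `j` and `-j` reads `P(x + jk) - P(x) =
2jk x`, because `r_0 = X`. So `P` has degree two. -/
lemma natDegree_add_natDegree_neg {j : ℤ} (hj : j ≠ 0) :
    (r j).natDegree + (r (-j)).natDegree = 2 := by
  have hjk : (j * k : R) ≠ 0 := mul_ne_zero (by exact_mod_cast hj) hr.ne_zero
  have h := hr.rel j (-j)
  set P := r j * taylor (-(j * k)) (r (-j)) with hPdef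
  have hP : taylor (j * k) P - P = C (2 * (j * k)) * X := by
    rw [hPdef, taylor_mul, taylor_taylor]
    simp only [add_neg_cancel, taylor_zero]
    push_cast at h
    rw [neg_mul, neg_neg, add_neg_cancel, hr.zero] at h
    have : C (2 * (j * k)) = - C (k * (-j - j) : R) := by rw [← C_neg]; congr 1; ring
    rw [this]
    linear_combination -h
  obtain ⟨h2, hl⟩ := natDegree_eq_two_of_taylor_sub hjk hP
  have hne : r j ≠ 0 ∧ r (-j) ≠ 0 := by
    constructor <;> · intro h0; rw [hPdef, h0] at h2; simp at h2
  rw [hPdef, natDegree_mul hne.1 (by simpa using hne.2), natDegree_taylor] at h2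
  exact h2

/-- If `r_j` were constant, `r_{-j}` would be quadratic. But the relation between `j` and `-2j`
would write a nonzero multiple of `r_{-j}` as a constant times a difference of `r_{-2j}`, which has
degree at most two, so the quadratic coefficient would cancel. -/
lemma natDegree_ne_zero {j : ℤ} (hj : j ≠ 0) : (r j).natDegree ≠ 0 := by
  intro h0
  have h2 : (r (-j)).natDegree = 2 := by
    have := hr.natDegree_add_natDegree_neg hj; omega
  have h3 : (r (-(2 * j))).natDegree ≤ 2 := by
    have := hr.natDegree_add_natDegree_neg (j := -(2 * j)) (by omega); omega
  obtain ⟨c, hc⟩ := natDegree_eq_zero.mp h0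
  have h := congrArg (coeff · 2) (hr.rel j (-(2 * j)))
  rw [← hc, show j + -(2 * j) = -j by ring] at h
  simp only [taylor_C, coeff_sub, coeff_C_mul, coeff_mul_C,
    coeff_taylor_of_natDegree_le' h3] at h
  have hne : (r (-j)).coeff 2 ≠ 0 := by
    rw [← h2, coeff_natDegree, Ne, leadingCoeff_eq_zero]
    intro h0; simp [h0] at h2
  have : k * (-(3 * j)) * (r (-j)).coeff 2 = 0 := by
    push_cast at h
    linear_combination -h
  have hj' : (j : R) ≠ 0 := by exact_mod_cast hj
  simp [hr.ne_zero, hne, hj'] at this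

lemma natDegree_eq_one (j : ℤ) : (r j).natDegree = 1 := by
  by_cases hj : j = 0
  · rw [hj, hr.zero, natDegree_X]
  have h1 := hr.natDegree_add_natDegree_neg hj
  have h2 := hr.natDegree_ne_zero hj
  have h3 := hr.natDegree_ne_zero (j := -j) (by omega)
  omega

/-- The leading coefficients are multiplicative on distinct indices, so `c 1 * c (-1) = c 0 = 1`
makes `c 1` a unit. The indices `±2` are included because sums of two elements of level one are
later compared with doubled ones. -/
lemma exists_unit : ∃ (c : Rˣ) (a : R), r 1 = C (c : R) * (X + C a) ∧
    r (-1) = C ((c⁻¹ : Rˣ) : R) * (X - C a) ∧ r 2 = C ((c : R) ^ 2) * (X + C (2 * a)) ∧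
    r (-2) = C (((c⁻¹ : Rˣ) : R) ^ 2) * (X - C (2 * a)) := by
  have hform : ∀ j, r j = C ((r j).coeff 1) * X + C ((r j).coeff 0) := fun j =>
    eq_X_add_C_of_natDegree_le_one (hr.natDegree_eq_one j).le
  set c : ℤ → R := fun j => (r j).coeff 1 with hcdef
  set d : ℤ → R := fun j => (r j).coeff 0 with hddef
  have hform : ∀ j, r j = C (c j) * X + C (d j) := hform
  have hc : ∀ j, c j ≠ 0 := by
    intro j h0
    have h1 := hform j
    rw [h0] at h1
    have := hr.natDegree_eq_one j
    rw [h1] at this; simp at this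
  have hev : ∀ i j (x : R), (c i * x + d i) * (c j * (x - i * k) + d j) -
      (c j * x + d j) * (c i * (x - j * k) + d i) =
        k * (j - i) * (c (i + j) * x + d (i + j)) := by
    intro i j x
    have := congrArg (eval x) (hr.rel i j)
    rw [hform i, hform j, hform (i + j)] at this
    simpa [taylor_eval, sub_eq_add_neg, add_comm, taylor_mul] using this
  have hD : ∀ i j, j * (c i * d j) - i * (c j * d i) = (j - i) * d (i + j) := by
    intro i j
    apply mul_left_cancel₀ hr.ne_zero
    linear_combination hev i j 0
  have hC : ∀ i j : ℤ, i ≠ j → c (i + j) = c i * c j := by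
    intro i j hij
    have hij' : (j - i : R) ≠ 0 := by
      rw [sub_ne_zero]; exact_mod_cast hij.symm
    apply mul_left_cancel₀ hr.ne_zero
    apply mul_left_cancel₀ hij'
    linear_combination hev i j 0 - hev i j 1
  have c0 : c 0 = 1 := by simp [hcdef, hr.zero]
  have d0 : d 0 = 0 := by simp [hddef, hr.zero]
  -- Multiplicativity is not available for `1 + 1`. Instead `c 5` is computed both as `c 1 * c 4`
  -- and as `c 2 * c 3`.
  have c2 : c 2 = c 1 ^ 2 := by
    have h3 := hC 1 2 (by norm_num)
    have h4 := hC 1 3 (by norm_num)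
    have h5 := hC 1 4 (by norm_num)
    have h5' := hC 2 3 (by norm_num)
    norm_num at h3 h4 h5 h5'
    have : c 1 * c 2 * (c 2 - c 1 ^ 2) = 0 := by
      rw [h4, h3] at h5; rw [h3] at h5'
      linear_combination h5 - h5'
    simpa [hc, sub_eq_zero] using this
  have cneg : ∀ j : ℤ, j ≠ 0 → c j * c (-j) = 1 := by
    intro j hj
    rw [← hC j (-j) (by omega), add_neg_cancel, c0]
  have dneg : ∀ j : ℤ, j ≠ 0 → c j * d (-j) = - (c (-j) * d j) := by
    intro j hj
    have h := hD j (-j)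
    rw [add_neg_cancel, d0] at h
    push_cast at h
    have hj' : (j : R) ≠ 0 := by exact_mod_cast hj
    apply mul_left_cancel₀ hj'
    linear_combination -h
  have h1 := cneg 1 (by norm_num)
  have h2 := cneg 2 (by norm_num)
  have e1 := dneg 1 (by norm_num)
  have e2 := dneg 2 (by norm_num)
  have h21 := hD 2 (-1)
  norm_num at h21
  have h1' := h1
  rw [mul_comm] at h1'
  have d2 : d 2 = 2 * c 1 * d 1 := by
    have : (2 : R) * (d 2 - 2 * c 1 * d 1) = 0 := by
      rw [c2] at h21
      linear_combination (-c 1) * h21 - 2 * d 2 * h1 - c 1 ^ 2 * e1 + (c 1 * d 1) * h1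
    simpa [sub_eq_zero] using this
  have hm2 : c (-2) = c (-1) ^ 2 := by
    apply mul_left_cancel₀ (hc 2)
    rw [h2, c2]; linear_combination (-1 - c 1 * c (-1)) * h1
  refine ⟨⟨c 1, c (-1), h1, h1'⟩, c (-1) * d 1, ?_, ?_, ?_, ?_⟩
  · rw [hform 1]; simp only [mul_add, ← C_mul]; congr 2; linear_combination -d 1 * h1
  · rw [hform (-1)]
    simp only [Units.inv_mk, sub_eq_add_neg, ← C_neg, mul_add, ← C_mul]; congr 2
    linear_combination c (-1) * e1 - d (-1) * h1
  · rw [hform 2]; simp only [mul_add, ← C_mul, c2]; congr 2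
    linear_combination d2 - 2 * c 1 * d 1 * h1
  · rw [hform (-2)]
    simp only [Units.inv_mk, sub_eq_add_neg, ← C_neg, mul_add, ← C_mul, hm2]; congr 2
    apply mul_left_cancel₀ (hc 2)
    rw [e2, hm2, c2, d2]
    linear_combination (2 * c (-1) * d 1 * (c 1 * c (-1) + 1) - 2 * c (-1) * d 1) * h1

end IsWittFamily

end Polynomial

/-! ### Functional equations for the Block algebra and restriction to a direction -/

open MvPolynomial in
/-- A family of polynomials `g m` for which the operators `f ↦ g m * shift m f` satisfy the
relations of the Block algebra, with `L_0` acting by multiplication with `q ∂₁`. -/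
structure IsBlockFamily (q : ℂ) (g : ℤ × ℤ → MvPolynomial (Fin 2) ℂ) : Prop where
  ne_zero : q ≠ 0
  zero : g 0 = C q * X 0
  rel (m n : ℤ × ℤ) : g m * Omega.shift m (g n) - g n * Omega.shift n (g m) =
    C (Block.coeff q m n) * g (m + n)

namespace Omega

lemma eval_shift (m : ℤ × ℤ) (f : MvPolynomial (Fin 2) ℂ) (x y : ℂ) :
    MvPolynomial.eval ![x, y] (shift m f) = MvPolynomial.eval ![x - m.1, y - m.2] f := by
  have h : (MvPolynomial.aeval ![x, y]).comp (shift m) =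
      (MvPolynomial.aeval ![x - m.1, y - m.2] : MvPolynomial (Fin 2) ℂ →ₐ[ℂ] ℂ) := by
    ext i
    fin_cases i <;> simp [shift]
  simpa [MvPolynomial.aeval_eq_eval] using congrArg (fun φ => φ f) h

end Omega

namespace Block

open Polynomial

/-- The substitution `∂₁ ↦ x`, `∂₂ ↦ (m₂ x - t) / m₁` into polynomials in `x` over `ℂ[t]`. -/
noncomputable def lineSubst (m : ℤ × ℤ) : MvPolynomial (Fin 2) ℂ →ₐ[ℂ] ℂ[X][X] :=
  MvPolynomial.aeval ![X, C (C (m.1 : ℂ)⁻¹) * (C (C (m.2 : ℂ)) * X - C X)]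

lemma lineSubst_C (m : ℤ × ℤ) (a : ℂ) : lineSubst m (MvPolynomial.C a) = C (C a) := by
  rw [lineSubst, MvPolynomial.aeval_C]
  rfl

lemma lineSubst_X_zero (m : ℤ × ℤ) : lineSubst m (MvPolynomial.X 0) = X := by
  simp [lineSubst]

lemma lineSubst_X_one (m : ℤ × ℤ) : lineSubst m (MvPolynomial.X 1) =
    C (C (m.1 : ℂ)⁻¹) * (C (C (m.2 : ℂ)) * X - C X) := by
  simp [lineSubst]

lemma shift_X_zero (m : ℤ × ℤ) :
    Omega.shift m (MvPolynomial.X 0) = MvPolynomial.X 0 - MvPolynomial.C (m.1 : ℂ) := by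
  simp [Omega.shift]

lemma shift_X_one (m : ℤ × ℤ) :
    Omega.shift m (MvPolynomial.X 1) = MvPolynomial.X 1 - MvPolynomial.C (m.2 : ℂ) := by
  simp [Omega.shift]

lemma shift_C (m : ℤ × ℤ) (a : ℂ) : Omega.shift m (MvPolynomial.C a) = MvPolynomial.C a :=
  (Omega.shift m).commutes a

/-- Translation by `j • m` leaves `t = m₂ ∂₁ - m₁ ∂₂` unchanged, so only the variable `x = ∂₁`
moves. -/
lemma lineSubst_shift {m : ℤ × ℤ} (hm : m.1 ≠ 0) (j : ℤ) (f : MvPolynomial (Fin 2) ℂ) :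
    lineSubst m (Omega.shift (j • m) f) = taylor (-((j : ℂ[X]) * C (m.1 : ℂ))) (lineSubst m f) := by
  have hm' : (m.1 : ℂ) ≠ 0 := by exact_mod_cast hm
  induction f using MvPolynomial.induction_on with
  | C a => rw [shift_C, lineSubst_C, taylor_C]
  | add p q hp hq => simp only [map_add, hp, hq]
  | mul_X p i hp =>
    have hX : lineSubst m (Omega.shift (j • m) (MvPolynomial.X i)) =
        taylor (-((j : ℂ[X]) * C (m.1 : ℂ))) (lineSubst m (MvPolynomial.X i)) := by
      fin_cases i
      · change lineSubst m (Omega.shift _ (MvPolynomial.X 0)) =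
          taylor _ (lineSubst m (MvPolynomial.X 0))
        rw [shift_X_zero, map_sub, lineSubst_X_zero, lineSubst_C, taylor_X]
        simp [sub_eq_add_neg]
      · change lineSubst m (Omega.shift _ (MvPolynomial.X 1)) =
          taylor _ (lineSubst m (MvPolynomial.X 1))
        rw [shift_X_one, map_sub, lineSubst_X_one, lineSubst_C, taylor_mul, map_sub, taylor_mul,
          taylor_C, taylor_C, taylor_C, taylor_X, Prod.smul_snd, smul_eq_mul, Int.cast_mul, C_mul,
          C_mul, C_neg, C_mul]
        have : (C (C ((m.1 : ℂ)⁻¹)) * C (C (m.1 : ℂ)) : ℂ[X][X]) = 1 := by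
          rw [← C_mul, ← C_mul, inv_mul_cancel₀ hm', C_1, C_1]
        generalize (C (C ((m.1 : ℂ)⁻¹)) : ℂ[X][X]) = u at this ⊢
        simp only [map_intCast] at this ⊢
        linear_combination (j * m.2 : ℂ[X][X]) * this
    rw [map_mul, map_mul, hp, map_mul, taylor_mul, hX]

lemma evalEval_lineSubst {m : ℤ × ℤ} (hm : m.1 ≠ 0) (f : MvPolynomial (Fin 2) ℂ) (x y : ℂ) :
    (lineSubst m f).evalEval (m.2 * x - m.1 * y) x = MvPolynomial.eval ![x, y] f := by
  have hm' : (m.1 : ℂ) ≠ 0 := by exact_mod_cast hm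
  induction f using MvPolynomial.induction_on with
  | C a => rw [lineSubst_C, evalEval_C, eval_C, MvPolynomial.eval_C]
  | add p q hp hq => simp only [map_add, evalEval_add, hp, hq]
  | mul_X p i hp =>
    rw [map_mul, evalEval_mul, map_mul, hp]
    congr 1
    fin_cases i
    · change (lineSubst m (MvPolynomial.X 0)).evalEval _ _ = _
      rw [lineSubst_X_zero]
      simp
    · change (lineSubst m (MvPolynomial.X 1)).evalEval _ _ = _
      rw [lineSubst_X_one]
      simp only [evalEval_mul, evalEval_sub, evalEval_C, evalEval_X, eval_C, eval_X]
      simp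
      field_simp

end Block

namespace IsBlockFamily

open Polynomial

variable {q : ℂ} {g : ℤ × ℤ → MvPolynomial (Fin 2) ℂ} (hg : IsBlockFamily q g)
include hg

lemma eval_rel (m n : ℤ × ℤ) (x y : ℂ) :
    MvPolynomial.eval ![x, y] (g m) * MvPolynomial.eval ![x - m.1, y - m.2] (g n) -
      MvPolynomial.eval ![x, y] (g n) * MvPolynomial.eval ![x - n.1, y - n.2] (g m) =
    (n.1 * (m.2 + q) - m.1 * (n.2 + q)) * MvPolynomial.eval ![x, y] (g (m + n)) := by
  simpa [Omega.eval_shift, Block.coeff] using congrArg (MvPolynomial.eval ![x, y]) (hg.rel m n)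

/-- The structure constant of `L_{im}`, `L_{jm}` is `q m₁ (j - i)`. Dividing by `q` removes this
factor and normalises the zeroth member to `X`. -/
lemma isWittFamily {m : ℤ × ℤ} (hm : m.1 ≠ 0) :
    IsWittFamily (C (m.1 : ℂ)) fun j => C (C q⁻¹) * Block.lineSubst m (g (j • m)) where
  ne_zero := by simpa using hm
  zero := by
    rw [zero_smul, hg.zero, map_mul, Block.lineSubst_C, Block.lineSubst_X_zero, ← mul_assoc,
      ← C_mul, ← C_mul, inv_mul_cancel₀ hg.ne_zero, C_1, C_1, one_mul]
  rel i j := by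
    have h := congrArg (Block.lineSubst m) (hg.rel (i • m) (j • m))
    rw [map_sub, map_mul, map_mul, Block.lineSubst_shift hm, Block.lineSubst_shift hm, map_mul,
      Block.lineSubst_C, ← add_smul] at h
    have hk : Block.coeff q (i • m) (j • m) = q * (m.1 * (j - i)) := by
      simp [Block.coeff]; ring
    have hq : (C (C q⁻¹) * C (C q) : ℂ[X][X]) = 1 := by
      rw [← C_mul, ← C_mul, inv_mul_cancel₀ hg.ne_zero, C_1, C_1]
    rw [hk] at h
    simp only [taylor_mul, taylor_C, C_mul, C_sub] at h ⊢
    simp only [map_intCast] at h ⊢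
    linear_combination (C (C q⁻¹)) ^ 2 * h + (C (C q⁻¹) * (m.1 : ℂ[X][X]) * (j - i) *
      Block.lineSubst m (g ((i + j) • m))) * hq

/-- The units of `ℂ[t]` are the nonzero constants, so the unit in the Witt normal form is a scalar
`l`. Its other parameter stays an arbitrary polynomial in `t`. -/
lemma exists_eval_eq {m : ℤ × ℤ} (hm : m.1 ≠ 0) : ∃ l : ℂ, l ≠ 0 ∧ ∃ A : ℂ[X], ∀ x y,
    MvPolynomial.eval ![x, y] (g m) = l * (q * x + A.eval (m.2 * x - m.1 * y)) ∧
    MvPolynomial.eval ![x, y] (g (-m)) = l⁻¹ * (q * x - A.eval (m.2 * x - m.1 * y)) ∧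
    MvPolynomial.eval ![x, y] (g (2 • m)) = l ^ 2 * (q * x + 2 * A.eval (m.2 * x - m.1 * y)) ∧
    MvPolynomial.eval ![x, y] (g (-(2 • m))) =
      l⁻¹ ^ 2 * (q * x - 2 * A.eval (m.2 * x - m.1 * y)) := by
  obtain ⟨c, a, h1, h2, h3, h4⟩ := (hg.isWittFamily hm).exists_unit
  obtain ⟨l, hl, hc⟩ := isUnit_iff.mp c.isUnit
  have hl0 : l ≠ 0 := hl.ne_zero
  have hc' : ((c⁻¹ : ℂ[X]ˣ) : ℂ[X]) = C l⁻¹ := by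
    rw [Units.inv_eq_of_mul_eq_one_right]
    rw [← hc, ← C_mul, mul_inv_cancel₀ hl0, C_1]
  rw [← hc] at h1 h3
  rw [hc'] at h2 h4
  refine ⟨l, hl0, C q * a, fun x y => ?_⟩
  have key : ∀ (j : ℤ) (p : ℂ[X][X]), C (C q⁻¹) * Block.lineSubst m (g (j • m)) = p →
      MvPolynomial.eval ![x, y] (g (j • m)) = q * p.evalEval (m.2 * x - m.1 * y) x := by
    rintro j p rfl
    rw [evalEval_mul, Block.evalEval_lineSubst hm]
    have := hg.ne_zero
    simp [this]
  have e1 := key _ _ h1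
  have e2 := key _ _ h2
  have e3 := key _ _ h3
  have e4 := key _ _ h4
  rw [one_smul] at e1
  rw [neg_smul, one_smul] at e2
  rw [neg_smul] at e4
  refine ⟨e1.trans ?_, e2.trans ?_, Eq.trans ?_ (e3.trans ?_), Eq.trans ?_ (e4.trans ?_)⟩
  · simp [evalEval_C]; ring
  · simp [evalEval_C]; ring
  · congr 2
  · simp [evalEval_C]; ring
  · congr 2
  · simp [evalEval_C]; ring

end IsBlockFamily

/-! ### Affine dependence on the invariant coordinate -/

namespace Polynomial

/-- For fixed `v` both sides are polynomials in `u`. If `deg A = n + 2 ≥ 2`, their coefficients at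
`n + 2` and `n + 1` are incompatible as `v` varies. -/
lemma natDegree_le_one_of_bracket {q k ν : ℂ} (hq : q ≠ 0) (hk : k ≠ 0) (hν : ν ≠ 0)
    {A B D : ℂ[X]} (h : ∀ u v : ℂ,
      (q * (v - u) + A.eval u) * (q * (v - u - k) + B.eval (v - k)) -
        (q * (v - u) + B.eval v) * (q * (v - u - k) + A.eval (u + k)) =
      ν * (q * (v - u) + D.eval (u + v))) : A.natDegree ≤ 1 := by
  by_contra hA
  obtain ⟨n, hn⟩ : ∃ n, A.natDegree = n + 2 := ⟨A.natDegree - 2, by omega⟩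
  set α := A.coeff (n + 2) with hα
  have hα0 : α ≠ 0 := by
    rw [hα, ← hn, coeff_natDegree, Ne, leadingCoeff_eq_zero]
    rintro rfl
    simp at hn
  set E := taylor k A - A with hE
  have hpoly : ∀ v : ℂ, C (q * v) * (C (B.eval (v - k) - B.eval v) - E) -
      C q * (X * (C (B.eval (v - k) - B.eval v) - E)) + C (q * k * B.eval v) - C (q * k) * A +
      C (B.eval (v - k) - B.eval v) * A - C (B.eval v) * E =
      C ν * (C (q * v) - C q * X + taylor v D) := by
    intro v
    refine funext fun u => ?_
    simp only [eval_sub, eval_add, eval_mul, eval_C, eval_X, hE, taylor_eval]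
    linear_combination h u v
  have hE2 : ∀ N, n + 2 ≤ N → E.coeff N = 0 := by
    intro N hN
    rw [hE, coeff_sub, coeff_taylor_of_natDegree_le' (by omega), sub_self]
  have hE1 : E.coeff (n + 1) = (n + 2) * k * α := by
    rw [hE, coeff_sub, coeff_taylor_of_natDegree_le hn.le, hα]
    push_cast; ring
  have hD : D.natDegree ≤ n + 2 := by
    rw [natDegree_le_iff_coeff_eq_zero]
    intro N hN
    obtain ⟨N, rfl⟩ : ∃ N', N = N' + 1 := ⟨N - 1, by omega⟩
    have h1 := congrArg (coeff · (N + 1)) (hpoly 0)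
    simp only [coeff_sub, coeff_add, coeff_C_mul, coeff_X_mul, coeff_C_succ, coeff_X, taylor_zero,
      hE2 N (by omega), hE2 (N + 1) (by omega),
      coeff_eq_zero_of_natDegree_lt (show A.natDegree < N + 1 by omega),
      coeff_C_of_ne_zero (show N ≠ 0 by omega), if_neg (show ¬ 1 = N + 1 by omega)] at h1
    simpa [hν] using h1
  have hfst : ∀ v, q * (n + 2) * k * α - q * k * α + (B.eval (v - k) - B.eval v) * α =
      ν * D.coeff (n + 2) := by
    intro v
    have h1 := congrArg (coeff · (n + 2)) (hpoly v)
    simp only [coeff_sub, coeff_add, coeff_C_mul, coeff_X_mul, coeff_C_succ, coeff_X,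
      hE2 (n + 2) le_rfl, hE1, coeff_taylor_of_natDegree_le' hD,
      if_neg (show ¬ 1 = n + 2 by omega), ← hα] at h1
    linear_combination h1
  have hsnd : ∀ v, -(q * v * ((n + 2) * k * α)) -
      q * ((C (B.eval (v - k) - B.eval v)).coeff n - E.coeff n) - q * k * A.coeff (n + 1) +
      (B.eval (v - k) - B.eval v) * A.coeff (n + 1) - B.eval v * ((n + 2) * k * α) =
      ν * (- q * (X : ℂ[X]).coeff (n + 1) + (D.coeff (n + 1) + (n + 2) * v * D.coeff (n + 2))) := by
    intro v
    have h1 := congrArg (coeff · (n + 1)) (hpoly v)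
    simp only [coeff_sub, coeff_add, coeff_C_mul, coeff_X_mul, coeff_C_succ,
      hE1, coeff_taylor_of_natDegree_le hD] at h1
    push_cast at h1
    linear_combination h1
  -- The top coefficient shows that `B(v - k) - B(v)` does not depend on `v`. At `v = k` it equals
  -- `B(0) - B(k)`, the same quantity that appears on subtracting `hsnd 0` from `hsnd k`, so `B` is
  -- eliminated.
  have hδ : B.eval (0 - k) - B.eval 0 = B.eval (k - k) - B.eval k :=
    mul_right_cancel₀ hα0 (by linear_combination hfst 0 - hfst k)
  have h0 := hsnd 0
  rw [hδ] at h0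
  have hn2 : (n + 2 : ℂ) ≠ 0 := by exact_mod_cast (n + 1).succ_ne_zero
  have h1 := hsnd k
  have h2 := hfst k
  simp only [sub_self] at h0 h1 h2
  have : (n + 2) * k * ((n + 2) * (q * k * α)) = 0 := by
    linear_combination (n + 2) * k * h2 - (h1 - h0)
  simp [hn2, hk, hq, hα0] at this

end Polynomial

namespace IsBlockFamily

variable {q : ℂ} {g : ℤ × ℤ → MvPolynomial (Fin 2) ℂ} (hg : IsBlockFamily q g)
include hg

lemma exists_eval_eq_linear {m : ℤ × ℤ} (hm : m.1 ≠ 0) : ∃ l : ℂ, l ≠ 0 ∧ ∃ β b : ℂ, ∀ x y,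
    MvPolynomial.eval ![x, y] (g m) = l * (q * x + (β * (m.2 * x - m.1 * y) + b)) ∧
    MvPolynomial.eval ![x, y] (g (-m)) = l⁻¹ * (q * x - (β * (m.2 * x - m.1 * y) + b)) ∧
    MvPolynomial.eval ![x, y] (g (2 • m)) =
      l ^ 2 * (q * x + 2 * (β * (m.2 * x - m.1 * y) + b)) ∧
    MvPolynomial.eval ![x, y] (g (-(2 • m))) =
      l⁻¹ ^ 2 * (q * x - 2 * (β * (m.2 * x - m.1 * y) + b)) := by
  obtain ⟨l, hl, A, hA⟩ := hg.exists_eval_eq hm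
  have hm' : (m.1 : ℂ) ≠ 0 := by exact_mod_cast hm
  suffices h : A.natDegree ≤ 1 by
    have hAe := Polynomial.eq_X_add_C_of_natDegree_le_one h
    refine ⟨l, hl, A.coeff 1, A.coeff 0, fun x y => ?_⟩
    have : A.eval (m.2 * x - m.1 * y) = A.coeff 1 * (m.2 * x - m.1 * y) + A.coeff 0 := by
      conv_lhs => rw [hAe]
      simp
    rw [← this]
    exact hA x y
  obtain ⟨l', hl', B, hB⟩ := hg.exists_eval_eq (m := (m.1, m.2 + 1)) hm
  obtain ⟨l'', hl'', D, hD⟩ := hg.exists_eval_eq (m := m + (m.1, m.2 + 1))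
    (by simp only [Prod.fst_add]; omega)
  refine Polynomial.natDegree_le_one_of_bracket (ν := -m.1 * l'' / (l * l')) (B := B) (D := D)
    hg.ne_zero hm' (by simp [hm', hl, hl', hl'']) fun u v => ?_
  -- This is the point where the invariants of the directions `m` and `(m₁, m₂ + 1)` take the values
  -- `u` and `v`. The invariant of the sum is then `u + v`, and the structure constant is `-m₁`.
  have h := hg.eval_rel m (m.1, m.2 + 1) (v - u) ((m.2 * (v - u) - u) / m.1)
  simp only [(hA _ _).1, (hB _ _).1, (hD _ _).1] at h
  simp only [Prod.fst_add, Prod.snd_add] at h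
  push_cast at h
  have e1 : m.2 * (v - u) - m.1 * ((m.2 * (v - u) - u) / m.1) = u := by field_simp; ring
  have e2 : (m.2 + 1) * (v - u - m.1) - m.1 * ((m.2 * (v - u) - u) / m.1 - m.2) = v - m.1 := by
    field_simp; ring
  have e3 : (m.2 + 1) * (v - u) - m.1 * ((m.2 * (v - u) - u) / m.1) = v := by field_simp; ring
  have e4 : m.2 * (v - u - m.1) - m.1 * ((m.2 * (v - u) - u) / m.1 - (m.2 + 1)) = u + m.1 := by
    field_simp; ring
  have e5 : (m.2 + (m.2 + 1)) * (v - u) - (m.1 + m.1) * ((m.2 * (v - u) - u) / m.1) = u + v := by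
    field_simp; ring
  rw [e1, e2, e3, e4, e5] at h
  field_simp
  linear_combination h

end IsBlockFamily

/-! ### Determination of the scalars -/

/-- The relations satisfied by a sequence of nonzero numbers that force it to be geometric. -/
lemma eq_one_of_sq_eq_mul {l : ℤ → ℂ} {β : ℂ} (hl : ∀ i, l i ≠ 0)
    (h : ∀ j s : ℤ, s ≠ 0 → l j ^ 2 = β * (l (j + s) * l (j - s))) : β = 1 := by
  have h01 := h 0 1 (by norm_num)
  have h02 := h 0 2 (by norm_num)
  have h03 := h 0 3 (by norm_num)
  have h11 := h 1 1 (by norm_num)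
  have h1m := h (-1) 1 (by norm_num)
  have h21 := h 2 1 (by norm_num)
  have h2m := h (-2) 1 (by norm_num)
  norm_num at h01 h02 h03 h11 h1m h21 h2m
  have l0 := hl 0
  -- Multiply the relations for `l 1 ^ 2` and `l (-1) ^ 2`, and eliminate the products `l s * l
  -- (-s)`, each equal to `l 0 ^ 2 / β`. The same with `±2` gives `β ^ 2 = 1`.
  have h3 : β ^ 3 = 1 := by
    have : l 0 ^ 4 * (β ^ 3 - 1) = 0 := by
      have e1 : (l 1 * l (-1)) ^ 2 = β ^ 2 * l 0 ^ 2 * (l 2 * l (-2)) := by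
        linear_combination l (-1) ^ 2 * h11 + β * (l 2 * l 0) * h1m
      have e2 : β ^ 2 * (l 1 * l (-1)) ^ 2 = l 0 ^ 4 := by
        linear_combination -(l 0 ^ 2 + β * (l 1 * l (-1))) * h01
      linear_combination e2 - β ^ 2 * e1 + β ^ 3 * l 0 ^ 2 * h02
    simpa [l0, sub_eq_zero] using this
  have h2 : β ^ 2 = 1 := by
    have : l 0 ^ 4 * (β ^ 2 - 1) = 0 := by
      have e1 : (l 2 * l (-2)) ^ 2 = β ^ 2 * (l 3 * l (-3)) * (l 1 * l (-1)) := by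
        linear_combination l (-2) ^ 2 * h21 + β * (l 3 * l 1) * h2m
      have e2 : β ^ 2 * (l 2 * l (-2)) ^ 2 = l 0 ^ 4 := by
        linear_combination -(l 0 ^ 2 + β * (l 2 * l (-2))) * h02
      linear_combination e2 - β ^ 2 * e1 + β ^ 3 * (l 1 * l (-1)) * h03 + β ^ 2 * l 0 ^ 2 * h01
    simpa [l0, sub_eq_zero] using this
  linear_combination h3 - β * h2

lemma eq_mul_zpow_of_sq_eq_mul {l : ℤ → ℂ} (hl : ∀ i, l i ≠ 0)
    (h : ∀ j : ℤ, l j ^ 2 = l (j + 1) * l (j - 1)) (i : ℤ) :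
    l i = l 0 * (l 1 / l 0) ^ i := by
  have hρ : l 1 / l 0 ≠ 0 := div_ne_zero (hl 1) (hl 0)
  have hstep : ∀ j, l (j + 1) = l j * (l 1 / l 0) := by
    intro j
    induction j using Int.induction_on with
    | zero => field_simp [hl 0]; simp
    | succ j ih =>
      have := h (j + 1)
      rw [add_sub_cancel_right] at this
      apply mul_right_cancel₀ (hl j)
      linear_combination -this + l (j + 1) * ih
    | pred j ih =>
      have := h (-j)
      rw [sub_add_cancel]
      apply mul_left_cancel₀ (hl (-j))
      linear_combination this + l (-j - 1) * ih
  induction i using Int.induction_on with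
  | zero => simp
  | succ j ih => rw [hstep, ih, zpow_add₀ hρ, zpow_one, mul_assoc]
  | pred j ih =>
    apply mul_right_cancel₀ hρ
    rw [← hstep, sub_add_cancel, ih, mul_assoc, ← zpow_add_one₀ hρ, sub_add_cancel]

lemma eval_aeval_C_X (x y : ℂ) (f : MvPolynomial (Fin 2) ℂ) :
    (MvPolynomial.aeval ![Polynomial.C x, Polynomial.X] f).eval y = MvPolynomial.eval ![x, y] f := by
  induction f using MvPolynomial.induction_on with
  | C a => simp
  | add p q hp hq => simp only [map_add, Polynomial.eval_add, hp, hq]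
  | mul_X p i hp =>
    rw [map_mul, Polynomial.eval_mul, map_mul, hp, MvPolynomial.aeval_X, MvPolynomial.eval_X]
    fin_cases i <;> simp

/-! ### Normal form of the polynomials -/

namespace IsBlockFamily

variable {q : ℂ} {g : ℤ × ℤ → MvPolynomial (Fin 2) ℂ} (hg : IsBlockFamily q g)
include hg

lemma exists_coefficients : ∃ l β b : ℤ → ℂ, (∀ i, l i ≠ 0) ∧ ∀ (i : ℤ) (x y : ℂ),
    MvPolynomial.eval ![x, y] (g (1, i)) = l i * (q * x + (β i * (i * x - y) + b i)) ∧
    MvPolynomial.eval ![x, y] (g (-1, -i)) = (l i)⁻¹ * (q * x - (β i * (i * x - y) + b i)) ∧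
    MvPolynomial.eval ![x, y] (g (2, 2 * i)) =
      l i ^ 2 * (q * x + 2 * (β i * (i * x - y) + b i)) ∧
    MvPolynomial.eval ![x, y] (g (-2, -(2 * i))) =
      (l i)⁻¹ ^ 2 * (q * x - 2 * (β i * (i * x - y) + b i)) := by
  choose l hl β b h using fun i : ℤ => hg.exists_eval_eq_linear (m := (1, i)) one_ne_zero
  refine ⟨l, β, b, hl, fun i x y => ?_⟩
  simpa using h i x y

/-- The normal form, up to the choice of parameters, of the polynomials `g (1, i)`. -/
lemma exists_level_one : ∃ l₁ l₂ c : ℂ, l₁ ≠ 0 ∧ l₂ ≠ 0 ∧ ∀ (i : ℤ) (x y : ℂ),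
    MvPolynomial.eval ![x, y] (g (1, i)) = l₁ * l₂ ^ i * ((q + i) * x - (y - c)) ∧
    MvPolynomial.eval ![x, y] (g (-1, i)) = l₁⁻¹ * l₂ ^ i * ((q + i) * x + (y - c)) := by
  have hq := hg.ne_zero
  obtain ⟨l, β', b, hl, hG⟩ := hg.exists_coefficients
  -- On `x = 0`, brackets of levels `1` and `-1` make multiples of `g (0, i - j)` and `g (0, j - i)`
  -- affine in `y`, with slopes proportional to `β' i - β' j`. As `L_(0, i-j)` and `L_(0, j-i)`
  -- commute, the product of the slopes must vanish.
  have hβ' : ∀ i j, β' i = β' j := by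
    intro i j
    by_contra hne
    have hij : i - j ≠ 0 := by rintro h; rw [sub_eq_zero.mp h] at hne; exact hne rfl
    have hij' : (i - j : ℂ) ≠ 0 := by exact_mod_cast hij
    have r1 := fun y => hg.eval_rel (1, i) (-1, -j) 0 y
    have r2 := fun y => hg.eval_rel (1, j) (-1, -i) 0 y
    have r3 := fun y => hg.eval_rel (0, i - j) (0, -(i - j)) 0 y
    simp only [(hG _ _ _).1, (hG _ _ _).2.1, Prod.mk_add_mk, add_neg_cancel, ← sub_eq_add_neg]
      at r1 r2
    simp only [Int.cast_zero, sub_zero, zero_mul] at r3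
    rw [← neg_sub i j] at r2
    push_cast at r1 r2 r3
    set H := fun y => MvPolynomial.eval ![0, y] (g (0, i - j))
    set H' := fun y => MvPolynomial.eval ![0, y] (g (0, -(i - j)))
    have e1 : ∃ B : ℂ, ∀ y, (-1 * (i + q) - 1 * (-j + q)) * H y =
        l i * (l j)⁻¹ * (q * (β' i - β' j)) * y + B := by
      refine ⟨(-1 * (i + q) - 1 * (-j + q)) * H 0, fun y => ?_⟩
      simp only [H]
      rw [← r1, ← r1]
      ring
    have e2 : ∃ B : ℂ, ∀ y, (-1 * (j + q) - 1 * (-i + q)) * H' y =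
        l j * (l i)⁻¹ * (q * (β' j - β' i)) * y + B := by
      refine ⟨(-1 * (j + q) - 1 * (-i + q)) * H' 0, fun y => ?_⟩
      simp only [H']
      rw [← r2, ← r2]
      ring
    obtain ⟨B, e1⟩ := e1
    obtain ⟨B', e2⟩ := e2
    have r3 : ∀ y, H y * H' (y - (i - j)) - H' y * H (y - -(i - j)) = 0 := r3
    generalize hκ : (-1 * (i + q) - 1 * (-j + q) : ℂ) = κ at e1
    generalize hκ' : (-1 * (j + q) - 1 * (-i + q) : ℂ) = κ' at e2
    generalize hD : l i * (l j)⁻¹ * (q * (β' i - β' j)) = D at e1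
    generalize hD' : l j * (l i)⁻¹ * (q * (β' j - β' i)) = D' at e2
    have hDne : D ≠ 0 := by
      rw [← hD]; simp [hl, hq, sub_eq_zero, hne]
    have hDne' : D' ≠ 0 := by
      rw [← hD']; simp [hl, hq, sub_eq_zero, Ne.symm hne]
    have r4 : ∀ y, (D * y + B) * (D' * (y - (i - j)) + B') -
        (D' * y + B') * (D * (y - -(i - j)) + B) = 0 := by
      -- The commutation relation is multiplied by `κ * κ'` and never divided, since these structure
      -- constants vanish for some integral values of `2q`.
      intro y
      rw [← e1, ← e1, ← e2, ← e2]
      linear_combination κ * κ' * r3 y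
    have : 2 * (i - j) * (D * D') = 0 := by linear_combination r4 0 - r4 1
    simp [hij', hDne, hDne'] at this
  obtain ⟨β, hβ⟩ : ∃ β, ∀ i, β' i = β := ⟨β' 0, fun i => hβ' i 0⟩
  simp only [hβ] at hG
  have hE : ∀ (j s : ℤ) (x y : ℂ), _ := fun j s x y => hg.eval_rel (1, j + s) (1, j - s) x y
  simp only [Prod.mk_add_mk, add_add_sub_cancel, ← two_mul, mul_one,
    (hG _ _ _).1, (hG _ _ _).2.2.1] at hE
  push_cast at hE
  have hlβ : ∀ j s : ℤ, s ≠ 0 → l j ^ 2 = β * (l (j + s) * l (j - s)) := by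
    intro j s hs
    have hs' : (s : ℂ) ≠ 0 := by exact_mod_cast hs
    -- At `(1, j)` and `(0, 0)` the form `j x - y` vanishes. Subtracting the two relations removes
    -- the constants `b`.
    have h1 := hE j s 1 j
    have h0 := hE j s 0 0
    have : 2 * s * q * (l j ^ 2 - β * (l (j + s) * l (j - s))) = 0 := by
      linear_combination h0 - h1
    simpa [hs', hq, sub_eq_zero] using this
  obtain rfl : β = 1 := eq_one_of_sq_eq_mul hl hlβ
  simp only [one_mul] at hlβ
  have hb1 : ∀ j s : ℤ, s ≠ 0 →
      q * (b (j - s) - b (j + s)) + 2 * s * (b (j + s) + b (j - s)) = 4 * s * b j := by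
    intro j s hs
    have h0 := hE j s 0 0
    rw [hlβ j s hs] at h0
    apply mul_left_cancel₀ (mul_ne_zero (hl (j + s)) (hl (j - s)))
    linear_combination h0
  have hb2 : ∀ j s : ℤ, s ≠ 0 →
      (2 * s + 3 * q) * (b (j - s) - b j) + (2 * s + q) * (b (j + s) - b j) = 0 := by
    intro j s hs
    have h0 := hg.eval_rel (1, j + s) (-2, -(2 * j)) 0 0
    rw [Prod.mk_add_mk, show (1 : ℤ) + -2 = -1 by norm_num,
      show j + s + -(2 * j) = -(j - s) by ring] at h0
    simp only [(hG _ _ _).1, (hG _ _ _).2.2.2, (hG _ _ _).2.1] at h0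
    push_cast at h0
    have hinv : (l (j - s))⁻¹ = l (j + s) * (l j)⁻¹ ^ 2 := by
      have h1 := hl (j - s)
      have h2 := hl j
      field_simp
      linear_combination hlβ j s hs
    rw [hinv] at h0
    have hne : l (j + s) * (l j)⁻¹ ^ 2 ≠ 0 :=
      mul_ne_zero (hl _) (pow_ne_zero _ (inv_ne_zero (hl _)))
    apply mul_left_cancel₀ hne
    linear_combination -h0
  have hb : ∀ i, b i = b 0 := by
    intro i
    by_cases hi : i = 0
    · rw [hi]
    have h1 := hb1 0 i hi
    have h2 := hb2 0 i hi
    simp only [zero_add, zero_sub] at h1 h2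
    -- `hb1` and `hb2` at `j = 0` are two linear equations in `b i - b 0` and `b (-i) - b 0`, with
    -- determinant `±4q²`.
    have : 4 * q ^ 2 * (b i - b 0) = 0 := by
      linear_combination -(2 * i + 3 * q) * h1 + (q + 2 * i) * h2
    simpa [hq, sub_eq_zero] using this
  have hl2 := eq_mul_zpow_of_sq_eq_mul hl fun j => hlβ j 1 one_ne_zero
  refine ⟨l 0, l 1 / l 0, b 0, hl 0, div_ne_zero (hl 1) (hl 0), fun i x y => ⟨?_, ?_⟩⟩
  · rw [(hG i x y).1, hb, hl2 i]; ring
  · have h1 := (hG (-i) x y).2.1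
    rw [neg_neg] at h1
    rw [h1, hb, hl2 (-i), mul_inv, zpow_neg, inv_inv]
    push_cast; ring

/-- The normal form of the polynomials `g m`. -/
theorem exists_eq : ∃ l₁ l₂ c : ℂ, l₁ ≠ 0 ∧ l₂ ≠ 0 ∧ ∀ (m : ℤ × ℤ) (x y : ℂ),
    MvPolynomial.eval ![x, y] (g m) =
      l₁ ^ m.1 * l₂ ^ m.2 * ((q + m.2) * x - m.1 * (y - c)) := by
  have hq := hg.ne_zero
  obtain ⟨l₁, l₂, c, h₁, h₂, hG⟩ := hg.exists_level_one
  refine ⟨l₁, l₂, c, h₁, h₂, ?_⟩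
  have hadd : ∀ (m n : ℤ × ℤ), n.1 * (m.2 + q) - m.1 * (n.2 + q) ≠ 0 →
      (∀ x y, MvPolynomial.eval ![x, y] (g m) =
        l₁ ^ m.1 * l₂ ^ m.2 * ((q + m.2) * x - m.1 * (y - c))) →
      (∀ x y, MvPolynomial.eval ![x, y] (g n) =
        l₁ ^ n.1 * l₂ ^ n.2 * ((q + n.2) * x - n.1 * (y - c))) →
      ∀ x y, MvPolynomial.eval ![x, y] (g (m + n)) =
        l₁ ^ (m + n).1 * l₂ ^ (m + n).2 * ((q + (m + n).2) * x - (m + n).1 * (y - c)) := by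
    intro m n hmn hm hn x y
    apply mul_left_cancel₀ hmn
    rw [← hg.eval_rel, hm, hn, hm, hn, Prod.fst_add, Prod.snd_add, zpow_add₀ h₁, zpow_add₀ h₂]
    push_cast
    ring
  have hstep : ∀ (ε k i : ℤ), ε + k ≠ 0 →
      (∀ i x y, MvPolynomial.eval ![x, y] (g (ε, i)) =
        l₁ ^ ε * l₂ ^ i * ((q + i) * x - ε * (y - c))) →
      (∀ i x y, MvPolynomial.eval ![x, y] (g (k, i)) =
        l₁ ^ k * l₂ ^ i * ((q + i) * x - k * (y - c))) →
      ∀ x y, MvPolynomial.eval ![x, y] (g (ε + k, i)) =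
        l₁ ^ (ε + k) * l₂ ^ i * ((q + i) * x - (ε + k : ℤ) * (y - c)) := by
    intro ε k i hεk hε hk
    have hεk' : (ε + k : ℂ) ≠ 0 := by exact_mod_cast hεk
    -- The structure constant is affine in `j` with slope `ε + k ≠ 0`, so it cannot vanish at both
    -- `0` and `1`.
    obtain ⟨j, hj⟩ : ∃ j : ℤ, (k * (j + q) - ε * ((i - j : ℤ) + q) : ℂ) ≠ 0 := by
      by_contra! h
      have h0 := h 0
      have h1 := h 1
      push_cast at h0 h1
      exact hεk' (by linear_combination h1 - h0)
    have := hadd (ε, j) (k, i - j) hj (hε j) (hk (i - j))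
    simpa using this
  have hε : ∀ i x y, MvPolynomial.eval ![x, y] (g (1, i)) =
      l₁ ^ (1 : ℤ) * l₂ ^ i * ((q + i) * x - (1 : ℤ) * (y - c)) := by
    intro i x y; rw [(hG i x y).1]; simp
  have hε' : ∀ i x y, MvPolynomial.eval ![x, y] (g (-1, i)) =
      l₁ ^ (-1 : ℤ) * l₂ ^ i * ((q + i) * x - (-1 : ℤ) * (y - c)) := by
    intro i x y; rw [(hG i x y).2, zpow_neg_one]; push_cast; ring
  have hpos : ∀ (k : ℕ) (i : ℤ) (x y : ℂ), MvPolynomial.eval ![x, y] (g ((k + 1 : ℤ), i)) =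
      l₁ ^ (k + 1 : ℤ) * l₂ ^ i * ((q + i) * x - (k + 1 : ℤ) * (y - c)) := by
    intro k
    induction k with
    | zero => simpa using hε
    | succ k ih =>
      intro i
      have := hstep 1 (k + 1) i (by omega) hε ih
      rwa [show (1 + (k + 1) : ℤ) = ((k + 1 : ℕ) + 1 : ℤ) by push_cast; ring] at this
  have hneg : ∀ (k : ℕ) (i : ℤ) (x y : ℂ), MvPolynomial.eval ![x, y] (g (-(k + 1 : ℤ), i)) =
      l₁ ^ (-(k + 1 : ℤ)) * l₂ ^ i * ((q + i) * x - (-(k + 1 : ℤ) : ℤ) * (y - c)) := by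
    intro k
    induction k with
    | zero => simpa using hε'
    | succ k ih =>
      intro i
      have := hstep (-1) (-(k + 1)) i (by omega) hε' ih
      rwa [show (-1 + -(k + 1) : ℤ) = (-((k + 1 : ℕ) + 1) : ℤ) by push_cast; ring] at this
  rintro ⟨k, s⟩
  rcases lt_trichotomy k 0 with hk | rfl | hk
  · obtain ⟨n, rfl⟩ : ∃ n : ℕ, k = -(n + 1 : ℤ) := ⟨(-k - 1).toNat, by omega⟩
    exact hneg n s
  · by_cases hs : s = 0
    · subst hs
      intro x y
      have : g (0, 0) = MvPolynomial.C q * MvPolynomial.X 0 := hg.zero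
      simp [this]
    have hs' : (s : ℂ) ≠ 0 := by exact_mod_cast hs
    set e : MvPolynomial (Fin 2) ℂ :=
      g (0, s) - MvPolynomial.C (l₂ ^ s * (q + s)) * MvPolynomial.X 0 with he
    -- Brackets cannot always produce `L_(0, s)`: every structure constant leading to it vanishes
    -- when `s = -2q`. On the zero line of `g (1, i)`, however, the bracket of `L_(0, s)` with
    -- `L_(1, i)` loses one product and determines `g (0, s)`.
    have hline : ∀ (i : ℤ) (x : ℂ), MvPolynomial.eval ![x, (q + i) * x + c] e = 0 := by
      intro i x
      have h := hg.eval_rel (0, s) (1, i) x ((q + i) * x + c)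
      rw [Prod.mk_add_mk, zero_add] at h
      simp only [(hG _ _ _).1, zpow_add₀ h₂] at h
      push_cast at h
      have hne : l₁ * l₂ ^ i * s ≠ 0 := mul_ne_zero (mul_ne_zero h₁ (zpow_ne_zero _ h₂)) hs'
      apply mul_left_cancel₀ hne
      rw [he]
      simp only [map_sub, map_mul, MvPolynomial.eval_C, MvPolynomial.eval_X, Matrix.cons_val_zero]
      linear_combination h
    have he0 : e = 0 := by
      -- All the lines pass through `(0, c)`, so they give infinitely many zeros on each vertical
      -- line except `x = 0`. The factor `X 0` takes care of that one.
      have hX : MvPolynomial.X 0 * e = 0 := by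
        refine MvPolynomial.funext fun v => ?_
        obtain ⟨x, y, rfl⟩ : ∃ x y, v = ![x, y] := ⟨v 0, v 1, by ext i; fin_cases i <;> rfl⟩
        by_cases hx : x = 0
        · simp [hx]
        have hp : MvPolynomial.aeval ![Polynomial.C x, Polynomial.X] e = 0 := by
          refine Polynomial.eq_zero_of_infinite_isRoot _ (Set.infinite_of_injective_forall_mem
            (f := fun i : ℤ => (q + i) * x + c) (fun i j hij => ?_) fun i => ?_)
          · simpa [hx] using hij
          · rw [Set.mem_ofPred_eq, Polynomial.IsRoot.def, eval_aeval_C_X]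
            exact hline i x
        rw [map_mul, ← eval_aeval_C_X x y e, hp]
        simp
      exact (mul_eq_zero.mp hX).resolve_left (MvPolynomial.X_ne_zero 0)
    intro x y
    rw [sub_eq_zero.mp he0]
    simp
    ring
  · obtain ⟨n, rfl⟩ : ∃ n : ℕ, k = (n + 1 : ℤ) := ⟨(k - 1).toNat, by omega⟩
    exact hpos n s

end IsBlockFamily

/-! ### The enveloping algebra of the Cartan subalgebra and the module structure -/

noncomputable section

attribute [local instance 100] LieRing.ofAssociativeRing

open LieAlgebra

namespace BlockExt

open MvPolynomial

/-- `∂₁` as an element of the Cartan subalgebra. -/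
def cartan₁ (q : ℂ) : cartan q := ⟨del₁ q, Submodule.subset_span (by simp)⟩

/-- `∂₂` as an element of the Cartan subalgebra. -/
def cartan₂ (q : ℂ) : cartan q := ⟨del₂ q, Submodule.subset_span (by simp)⟩

lemma exists_cartan_eq (q : ℂ) (x : cartan q) :
    ∃ a b : ℂ, x = a • cartan₁ q + b • cartan₂ q := by
  obtain ⟨a, b, h⟩ := Submodule.mem_span_pair.mp x.2
  exact ⟨a, b, Subtype.ext h.symm⟩

lemma lie_cartan₁_cartan₂ (q : ℂ) : ⁅cartan₁ q, cartan₂ q⁆ = 0 :=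
  Subtype.ext (lie_del₁_del₂ q)

lemma cartan_lie_eq_zero (q : ℂ) (x y : cartan q) : ⁅x, y⁆ = 0 := by
  obtain ⟨a, b, rfl⟩ := exists_cartan_eq q x
  obtain ⟨c, d, rfl⟩ := exists_cartan_eq q y
  have h : ⁅cartan₂ q, cartan₁ q⁆ = 0 := by rw [← lie_skew, lie_cartan₁_cartan₂, neg_zero]
  simp only [add_lie, lie_add, smul_lie, lie_smul, lie_self, lie_cartan₁_cartan₂, h, smul_zero,
    add_zero]

/-- The linear map `𝔥 → ℂ[∂₁, ∂₂]`. -/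
def cartanToPolyₗ (q : ℂ) : BlockExt q →ₗ[ℂ] MvPolynomial (Fin 2) ℂ where
  -- The factor `q` reflects `L_0 = q ∂₁`; the remaining `L_m` do not occur in `𝔥` and are sent to
  -- zero.
  toFun x := (q * (Block.basis q).repr x.left 0) • X 0 + x.right • X 1
  map_add' x y := by
    simp [mul_add, add_smul]; abel
  map_smul' c x := by
    simp [mul_smul, smul_comm q c]

/-- The Lie algebra homomorphism `𝔥 → ℂ[∂₁, ∂₂]`. -/
def cartanToPoly (q : ℂ) : cartan q →ₗ⁅ℂ⁆ MvPolynomial (Fin 2) ℂ where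
  toLinearMap := cartanToPolyₗ q ∘ₗ (cartan q).toSubmodule.subtype
  map_lie' {x y} := by
    rw [cartan_lie_eq_zero, LieRing.of_associative_ring_bracket, mul_comm, sub_self]
    exact map_zero _

lemma cartanToPoly_cartan₁ {q : ℂ} (hq : q ≠ 0) : cartanToPoly q (cartan₁ q) = X 0 := by
  change cartanToPolyₗ q (del₁ q) = X 0
  simp [cartanToPolyₗ, del₁, incl, Block.L, hq]

lemma cartanToPoly_cartan₂ (q : ℂ) : cartanToPoly q (cartan₂ q) = X 1 := by
  change cartanToPolyₗ q (del₂ q) = X 1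
  simp [cartanToPolyₗ, del₂]

/-- The algebra homomorphism `U(𝔥) → ℂ[∂₁, ∂₂]`. -/
def uCartanToPoly (q : ℂ) : UCartan q →ₐ[ℂ] MvPolynomial (Fin 2) ℂ :=
  UniversalEnvelopingAlgebra.lift ℂ (cartanToPoly q)

/-- The enveloping algebra is generated by the image of `𝔥`, whose elements commute. Generation
follows from the universal property: lifting `ι` into the generated subalgebra and including back is
the identity. -/
lemma uCartan_mul_comm (q : ℂ) (u v : UCartan q) : u * v = v * u := by
  let ι := UniversalEnvelopingAlgebra.ι ℂ (L := cartan q)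
  have htop : Algebra.adjoin ℂ (Set.range ι) = ⊤ := by
    let f : cartan q →ₗ⁅ℂ⁆ Algebra.adjoin ℂ (Set.range ι) :=
      { toFun := fun x => ⟨ι x, Algebra.subset_adjoin ⟨x, rfl⟩⟩
        map_add' := fun x y => Subtype.ext (map_add ι x y)
        map_smul' := fun c x => Subtype.ext (map_smul ι c x)
        map_lie' := fun {x y} => Subtype.ext (LieHom.map_lie ι x y) }
    have hf : (Algebra.adjoin ℂ (Set.range ι)).val.comp (UniversalEnvelopingAlgebra.lift ℂ f) =
        AlgHom.id ℂ (UCartan q) := by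
      ext x
      simp [f, ι]
    refine Algebra.eq_top_iff.mpr fun u => ?_
    rw [← AlgHom.id_apply (R := ℂ) u, ← hf]
    exact (UniversalEnvelopingAlgebra.lift ℂ f u).2
  have hcomm : ∀ a ∈ Set.range ι, ∀ b ∈ Set.range ι, a * b = b * a := by
    rintro _ ⟨a, rfl⟩ _ ⟨b, rfl⟩
    have : ⁅ι a, ι b⁆ = 0 := by rw [← LieHom.map_lie, cartan_lie_eq_zero, map_zero]
    rwa [LieRing.of_associative_ring_bracket, sub_eq_zero] at this
  have h := (Algebra.isMulCommutative_adjoin ℂ hcomm).is_comm.comm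
    ⟨u, by rw [htop]; trivial⟩ ⟨v, by rw [htop]; trivial⟩
  exact congrArg Subtype.val h

instance (q : ℂ) : CommRing (UCartan q) where
  mul_comm := uCartan_mul_comm q

/-- The algebra homomorphism `ℂ[∂₁, ∂₂] → U(𝔥)`. -/
def polyToUCartan (q : ℂ) : MvPolynomial (Fin 2) ℂ →ₐ[ℂ] UCartan q :=
  aeval ![UniversalEnvelopingAlgebra.ι ℂ (cartan₁ q), UniversalEnvelopingAlgebra.ι ℂ (cartan₂ q)]

/-- `U(𝔥) = ℂ[∂₁, ∂₂]`. -/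
def uCartanEquivPoly {q : ℂ} (hq : q ≠ 0) : UCartan q ≃ₐ[ℂ] MvPolynomial (Fin 2) ℂ :=
  AlgEquiv.ofAlgHom (uCartanToPoly q) (polyToUCartan q)
    (by
      ext i : 1
      fin_cases i <;> simp [polyToUCartan, uCartanToPoly, cartanToPoly_cartan₁ hq,
        cartanToPoly_cartan₂])
    (by
      ext x
      obtain ⟨a, b, rfl⟩ := exists_cartan_eq q x
      simp [polyToUCartan, uCartanToPoly, cartanToPoly_cartan₁ hq, cartanToPoly_cartan₂])

lemma uCartanEquivPoly_ι₁ {q : ℂ} (hq : q ≠ 0) :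
    uCartanEquivPoly hq (UniversalEnvelopingAlgebra.ι ℂ (cartan₁ q)) = X 0 := by
  simp [uCartanEquivPoly, uCartanToPoly, cartanToPoly_cartan₁ hq]

lemma uCartanEquivPoly_ι₂ {q : ℂ} (hq : q ≠ 0) :
    uCartanEquivPoly hq (UniversalEnvelopingAlgebra.ι ℂ (cartan₂ q)) = X 1 := by
  simp [uCartanEquivPoly, uCartanToPoly, cartanToPoly_cartan₂]

variable {q : ℂ} {M : Type*} [AddCommGroup M] [Module ℂ M] [LieRingModule (BlockExt q) M]
  [LieModule ℂ (BlockExt q) M]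

/-- A `ℬ'(q)`-module that is `U(𝔥)`-free of rank one is `ℂ[∂₁, ∂₂]`, with `∂₁` and `∂₂` acting by
multiplication. -/
lemma IsUhFree.exists_linearEquiv (hq : q ≠ 0) (h : IsUhFree q 1 M) :
    ∃ e : M ≃ₗ[ℂ] MvPolynomial (Fin 2) ℂ,
      (∀ v, e ⁅del₁ q, v⁆ = X 0 * e v) ∧ ∀ v, e ⁅del₂ q, v⁆ = X 1 * e v := by
  let _ : Module (UCartan q) M := uCartanModule q M
  obtain ⟨b⟩ : Nonempty (Module.Basis (Fin 1) (UCartan q) M) := h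
  have hsmul : ∀ (u : UCartan q) (v : M),
      u • v = UniversalEnvelopingAlgebra.lift ℂ (LieModule.toEnd ℂ (cartan q) M) u v :=
    fun _ _ => rfl
  have hι : ∀ (x : cartan q) (v : M), UniversalEnvelopingAlgebra.ι ℂ x • v = ⁅(x : BlockExt q), v⁆ := by
    intro x v
    rw [hsmul, UniversalEnvelopingAlgebra.lift_ι_apply]
    rfl
  have halg : ∀ (c : ℂ) (v : M), algebraMap ℂ (UCartan q) c • v = c • v := by
    intro c v
    rw [hsmul, AlgHom.commutes]
    rfl
  let F : M ≃ₗ[UCartan q] UCartan q := b.equivFun.trans (LinearEquiv.funUnique (Fin 1) _ _)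
  have hF : ∀ (u : UCartan q) (v : M), F (u • v) = u * F v := fun u v => map_smul F u v
  let e : M ≃ₗ[ℂ] MvPolynomial (Fin 2) ℂ :=
    { toFun := fun v => uCartanEquivPoly hq (F v)
      invFun := fun f => F.symm ((uCartanEquivPoly hq).symm f)
      left_inv := fun v => by simp
      right_inv := fun f => by simp
      map_add' := fun v w => by simp
      map_smul' := fun c v => by
        rw [← halg, hF, map_mul, AlgEquiv.commutes, RingHom.id_apply, Algebra.smul_def] }
  refine ⟨e, fun v => ?_, fun v => ?_⟩
  · change uCartanEquivPoly hq (F _) = X 0 * uCartanEquivPoly hq (F v)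
    rw [← uCartanEquivPoly_ι₁ hq, ← map_mul, ← hF, hι]
    rfl
  · change uCartanEquivPoly hq (F _) = X 1 * uCartanEquivPoly hq (F v)
    rw [← uCartanEquivPoly_ι₂ hq, ← map_mul, ← hF, hι]
    rfl

variable (q) (e : M ≃ₗ[ℂ] MvPolynomial (Fin 2) ℂ)

/-- The polynomial by which `L_m` acts on `1`, for a `ℬ'(q)`-module identified with
`ℂ[∂₁, ∂₂]`. -/
def actionPoly (m : ℤ × ℤ) : MvPolynomial (Fin 2) ℂ :=
  e ⁅incl q (Block.L q m), e.symm 1⁆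

variable {q e}

/-- Moving `∂ᵢ` past `L_m` replaces it by `∂ᵢ - mᵢ`, so the action of `L_m` is determined by its
value on `1`. -/
lemma apply_lie_L (hq : q ≠ 0) (h₁ : ∀ v, e ⁅del₁ q, v⁆ = X 0 * e v)
    (h₂ : ∀ v, e ⁅del₂ q, v⁆ = X 1 * e v) (m : ℤ × ℤ) (v : M) :
    e ⁅incl q (Block.L q m), v⁆ = actionPoly q e m * Omega.shift m (e v) := by
  obtain ⟨f, rfl⟩ := e.symm.surjective v
  rw [LinearEquiv.apply_symm_apply]
  induction f using MvPolynomial.induction_on with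
  | C a =>
    have : e.symm (C a) = a • e.symm 1 := by rw [← map_smul, smul_eq_C_mul, mul_one]
    rw [this, lie_smul, map_smul, smul_eq_C_mul, Block.shift_C, mul_comm]
    rfl
  | add f g hf hg => simp only [map_add, lie_add, hf, hg, mul_add]
  | mul_X f i hf =>
    fin_cases i
    · change e ⁅_, e.symm (f * X 0)⁆ = _ * Omega.shift m (f * X 0)
      have : e.symm (f * X 0) = ⁅del₁ q, e.symm f⁆ := by
        apply e.injective
        rw [h₁, LinearEquiv.apply_symm_apply, LinearEquiv.apply_symm_apply, mul_comm]
      rw [this, leibniz_lie, ← lie_skew, lie_del₁_L q hq, neg_lie, smul_lie, map_add, map_neg,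
        map_smul, h₁, hf, map_mul, Block.shift_X_zero, smul_eq_C_mul]
      ring
    · change e ⁅_, e.symm (f * X 1)⁆ = _ * Omega.shift m (f * X 1)
      have : e.symm (f * X 1) = ⁅del₂ q, e.symm f⁆ := by
        apply e.injective
        rw [h₂, LinearEquiv.apply_symm_apply, LinearEquiv.apply_symm_apply, mul_comm]
      rw [this, leibniz_lie, ← lie_skew, lie_del₂_L q, neg_lie, smul_lie, map_add, map_neg,
        map_smul, h₂, hf, map_mul, Block.shift_X_one, smul_eq_C_mul]
      ring

lemma isBlockFamily_actionPoly (hq : q ≠ 0) (h₁ : ∀ v, e ⁅del₁ q, v⁆ = X 0 * e v)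
    (h₂ : ∀ v, e ⁅del₂ q, v⁆ = X 1 * e v) : IsBlockFamily q (actionPoly q e) where
  ne_zero := hq
  zero := by
    have : incl q (Block.L q 0) = q • del₁ q := by rw [del₁, smul_inv_smul₀ hq]
    rw [actionPoly, this, smul_lie, map_smul, h₁, LinearEquiv.apply_symm_apply, mul_one,
      smul_eq_C_mul]
  rel m n := by
    have hL : ⁅incl q (Block.L q m), incl q (Block.L q n)⁆ =
        Block.coeff q m n • incl q (Block.L q (m + n)) := by
      rw [← LieHom.map_lie, Block.lie_L_L, map_smul]
      rfl
    have hdef : ∀ k, e ⁅incl q (Block.L q k), e.symm 1⁆ = actionPoly q e k := fun _ => rfl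
    have h := congrArg e (lie_lie (incl q (Block.L q m)) (incl q (Block.L q n)) (e.symm 1))
    rw [hL, smul_lie, map_smul, map_sub, apply_lie_L hq h₁ h₂ m ⁅_, _⁆,
      apply_lie_L hq h₁ h₂ n ⁅_, _⁆,
      smul_eq_C_mul, hdef, hdef, hdef] at h
    exact h.symm

theorem IsUhFree.exists_linearEquiv_omega (hq : q ≠ 0) (h : IsUhFree q 1 M) :
    ∃ (lam₁ lam₂ : ℂˣ) (α : ℂ) (E : M ≃ₗ[ℂ] Omega q lam₁ lam₂ α),
      ∀ (x : BlockExt q) (v : M), E ⁅x, v⁆ = ⁅x, E v⁆ := by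
  obtain ⟨e, h₁, h₂⟩ := h.exists_linearEquiv hq
  obtain ⟨l₁, l₂, c, hl₁, hl₂, hg⟩ := (isBlockFamily_actionPoly hq h₁ h₂).exists_eq
  -- Matching `y - c` with `q α + ∂₂` gives `α = -c / q`.
  refine ⟨Units.mk0 l₁ hl₁, Units.mk0 l₂ hl₂, -c / q,
    e.trans (Omega.toPoly q _ _ _).symm, fun x v => ?_⟩
  have hpoly : ∀ m, actionPoly q e m =
      Omega.gPoly q (Units.mk0 l₁ hl₁) (Units.mk0 l₂ hl₂) (-c / q) m := by
    intro m
    refine MvPolynomial.funext fun v => ?_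
    obtain ⟨x, y, rfl⟩ : ∃ x y, v = ![x, y] := ⟨v 0, v 1, by ext i; fin_cases i <;> rfl⟩
    rw [hg]
    simp only [Omega.gPoly, Units.val_mk0, map_mul, map_sub, map_add, eval_C, eval_X,
      Matrix.cons_val_zero, Matrix.cons_val_one]
    field_simp
    ring
  apply (Omega.toPoly q _ _ _).injective
  rw [LinearEquiv.trans_apply, LinearEquiv.apply_symm_apply, LinearEquiv.trans_apply]
  have hL : ∀ y : Block q, e ⁅incl q y, v⁆ =
      Omega.toPoly q _ _ _ ⁅incl q y, (Omega.toPoly q (Units.mk0 l₁ hl₁) (Units.mk0 l₂ hl₂)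
        (-c / q)).symm (e v)⁆ := by
    intro y
    induction y using Block.induction with
    | zero => rw [map_zero, zero_lie, zero_lie, map_zero, map_zero]
    | add y z hy hz => simp only [map_add, add_lie, hy, hz]
    | smul a y hy => simp only [map_smul, smul_lie, hy]
    | basis m => rw [apply_lie_L hq h₁ h₂, Omega.toPoly_lie_L, hpoly, LinearEquiv.apply_symm_apply]
  have hx : x = incl q x.left + x.right • del₂ q := by
    ext <;> simp [incl, del₂]
  rw [hx, add_lie, add_lie, map_add, map_add, hL, smul_lie, smul_lie, map_smul, map_smul, h₂,
    Omega.toPoly_lie_del₂, LinearEquiv.apply_symm_apply]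

end BlockExt

end

theorem theorem3p4 (q : ℂ) (hq : q ≠ 0) :
    (∀ (M : Type*) [AddCommGroup M] [Module ℂ M]
        [LieRingModule (BlockExt q) M] [LieModule ℂ (BlockExt q) M],
      BlockExt.IsUhFree q 1 M →
        ∃ (lam₁ lam₂ : ℂˣ) (α : ℂ), Nonempty (M ≃ₗ⁅ℂ, BlockExt q⁆ Omega q lam₁ lam₂ α)) ∧
    (∀ (M : Type*) [AddCommGroup M] [Module ℂ M]
        [LieRingModule (Block q) M] [LieModule ℂ (Block q) M],
      Block.IsUhFree q 1 M →
        ∃ (lam₁ lam₂ : ℂˣ) (α : ℂ), Nonempty (M ≃ₗ⁅ℂ, Block q⁆ Omega q lam₁ lam₂ α)) := by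
  refine ⟨fun M _ _ _ _ h => ?_, fun M _ _ _ _ h => ?_⟩
  · obtain ⟨lam₁, lam₂, α, E, hE⟩ := h.exists_linearEquiv_omega hq
    exact ⟨lam₁, lam₂, α, ⟨{ E with map_lie' := fun {x v} => hE x v }⟩⟩
  · obtain ⟨_, _, hincl, h⟩ := h
    obtain ⟨lam₁, lam₂, α, E, hE⟩ := h.exists_linearEquiv_omega hq
    refine ⟨lam₁, lam₂, α, ⟨{ E with map_lie' := fun {x v} => ?_ }⟩⟩
    -- The `ℬ(q)`-action on `Ω(λ, α)` is by definition restricted from `ℬ'(q)`, so the isomorphism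
    -- for the extended action restricts.
    change E ⁅x, v⁆ = ⁅BlockExt.incl q x, E v⁆
    rw [← hincl, hE]
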